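/- Let $m\ge 1$, let $(\Omega_i,\mathbb P_i)$, $1\le i\le m$, be probability spaces, and let $\mathbb P=\mathbb P_1\otimes\cdots\otimes\mathbb P_m$ on $\Omega=\Omega_1\times\cdots\times\Omega_m$. Let $T$ be a finite non-empty index set, and for every $t\in T$ let $X_{t_i}:\Omega_i\to\mathbb R$, $1\le i\le m$, be subgaussian random variables (so that, as random variables on $\Omega$, the coordinates for different $i$ are independent), where $$\|Y\|_{\psi_2}=\inf\{C>0:\ \mathbb E\exp(|Y|^2/C^2)-1\le 1\}$$ and $Y$ is subgaussian if $\|Y\|_{\psi_2}<\infty$. Put $$A_t=\frac1m\sum_{i=1}^m\big(X_{t_i}^2-\mathbb E X_{t_i}^2\big),\qquad d_{\psi_2}(s,t)=\max_{1\le i\le m}\|X_{s_i}-X_{t_i}\|_{\psi_2},\qquad \bar\Delta_{\psi_2}(T)=\sup_{t\in T}\max_{1\le i\le m}\|X_{t_i}\|_{\psi_2}.$$ For a semi-metric $d$ on $T$ and $1\le p<\infty$ let $$\gamma_{2,p}(T,d)=\inf_{(T_n)}\sup_{t\in T}\sum_{n\ge\lfloor\log_2 p\rfloor}2^{n/2}d(t,T_n),\qquad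 \gamma_2(T,d)=\inf_{(T_n)}\sup_{t\in T}\sum_{n\ge 0}2^{n/2}d(t,T_n),$$ where $d(t,T_n)=\inf_{s\in T_n}d(t,s)$ and the infima are over all sequences $(T_n)_{n\ge0}$ of subsets of $T$ with $|T_0|=1$ and $|T_n|\le 2^{2^n}$ for $n\ge1$. Then there are absolute constants $C_0,C,c>0$ such that, in every such situation, and for all $\sigma,K>0$ with $$\sup_{t\in T}\frac1m\sum_{i=1}^m\mathbb E\big|X_{t_i}^2-\mathbb E X_{t_i}^2\big|^q\le\frac{q!}{2}\sigma^2K^{q-2}\qquad(q=2,3,\ldots),$$ the following hold. For every $1\le p<\infty$, $$\Big(\mathbb E\sup_{t\in T}|A_t|^p\Big)^{1/p}\le C_0\Big(\frac1m\gamma_{2,p}^2(T,d_{\psi_2})+\frac{1}{\sqrt m}\bar\Delta_{\psi_2}(T)\,\gamma_{2,p}(T,d_{\psi_2})+\sqrt p\,\frac{\sigma}{\sqrt m}+p\,\frac Km\Big),$$ and for every $u\ge1$, $$\mathbb P\Big(\sup_{t\in T}|A_t|\ge C\Big(\frac1m\gamma_2^2(T,d_{\psi_2})+\frac{\bar\Delta_{\psi_2}(T)}{\sqrt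 m}\gamma_2(T,d_{\psi_2})\Big)+c\Big(\sqrt u\,\frac{\sigma}{\sqrt m}+u\,\frac Km\Big)\Big)\le e^{-u}.$$ -/

import Mathlib

open MeasureTheory
open scoped ENNReal NNReal

noncomputable section

namespace SupAverages

/-- The function `ψ_α(x) = exp(x^α) - 1`, for `x ≥ 0`. -/
def psi (α x : ℝ) : ℝ := Real.exp (x ^ α) - 1

/-- The `ψ_α`-norm `inf {C > 0 : E ψ_α(|X| / C) ≤ 1}` of a real random variable, as an extended
nonnegative number: it equals `∞` when no such `C` exists. -/
def psiNorm {Ω : Type*} [MeasurableSpace Ω] (α : ℝ) (X : Ω → ℝ) (P : Measure Ω) : ℝ≥0∞ :=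
  ⨅ (C : ℝ≥0) (_ : 0 < C) (_ : ∫⁻ ω, ENNReal.ofReal (psi α (|X ω| / C)) ∂P ≤ 1), (C : ℝ≥0∞)

/-- A random variable is subgaussian if its `ψ_2`-norm is finite. -/
def IsSubgaussian {Ω : Type*} [MeasurableSpace Ω] (X : Ω → ℝ) (P : Measure Ω) : Prop :=
  psiNorm 2 X P < ∞

/-- Admissible sequences `(T_n)` of subsets of `T`: `|T_0| = 1` and `|T_n| ≤ 2^(2^n)` for
`n ≥ 1`. -/
def IsAdmissible {T : Type*} (S : ℕ → Finset T) : Prop :=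
  (S 0).card = 1 ∧ ∀ n : ℕ, 1 ≤ n → (S n).card ≤ 2 ^ 2 ^ n

/-- The distance `d(t, S) = inf_{s ∈ S} d(t, s)`; it is `∞` if `S` is empty. -/
def distTo {T : Type*} (d : T → T → ℝ≥0∞) (t : T) (S : Finset T) : ℝ≥0∞ :=
  ⨅ s ∈ S, d t s

/-- The functional `γ_α(T, d) = inf sup_t ∑_{n ≥ 0} 2^(n/α) d(t, T_n)`, the infimum being over all
admissible sequences. -/
def gammaFun {T : Type*} (α : ℝ) (d : T → T → ℝ≥0∞) : ℝ≥0∞ :=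
  ⨅ (S : ℕ → Finset T) (_ : IsAdmissible S),
    ⨆ t : T, ∑' n : ℕ, (2 : ℝ≥0∞) ^ ((n : ℝ) / α) * distTo d t (S n)

/-- The truncated functional `γ_{α,p}(T, d)`, for `p ≥ 1`: the sum runs over `n ≥ ⌊log₂ p⌋`
only. -/
def gammaTrunc {T : Type*} (α p : ℝ) (d : T → T → ℝ≥0∞) : ℝ≥0∞ :=
  ⨅ (S : ℕ → Finset T) (_ : IsAdmissible S),
    ⨆ t : T, ∑' n : Set.Ici ⌊Real.logb 2 p⌋₊,
      (2 : ℝ≥0∞) ^ (((n : ℕ) : ℝ) / α) * distTo d t (S n)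

section Averages

variable {m : ℕ} {Ω : Fin m → Type*} [∀ i, MeasurableSpace (Ω i)] {T : Type*}

/-- The semi-metric `d_{ψ₂}(s, t) = max_i ‖X_{s_i} - X_{t_i}‖_{ψ₂}` on the index set. -/
def dPsi2 (P : ∀ i, Measure (Ω i)) (X : T → ∀ i, Ω i → ℝ) (s t : T) : ℝ≥0∞ :=
  ⨆ i, psiNorm 2 (fun x => X s i x - X t i x) (P i)

/-- The radius `sup_t max_i ‖X_{t_i}‖_{ψ₂}` of the index set. -/
def radPsi2 (P : ∀ i, Measure (Ω i)) (X : T → ∀ i, Ω i → ℝ) : ℝ≥0∞ :=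
  ⨆ (t : T) (i : Fin m), psiNorm 2 (X t i) (P i)

/-- The average of squares `A_t = (1/m) ∑_i (X_{t_i}² - E X_{t_i}²)`, a random variable on the
product space `∏_i Ω_i`. -/
def avgSq (P : ∀ i, Measure (Ω i)) (X : T → ∀ i, Ω i → ℝ) (t : T) (ω : ∀ i, Ω i) : ℝ :=
  (1 / (m : ℝ)) * ∑ i, (X t i (ω i) ^ 2 - ∫ x, X t i x ^ 2 ∂(P i))

/-- The supremum `sup_t |A_t|`. -/
def supAvgSq (P : ∀ i, Measure (Ω i)) (X : T → ∀ i, Ω i → ℝ) (ω : ∀ i, Ω i) : ℝ≥0∞ :=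
  ⨆ t : T, ENNReal.ofReal |avgSq P X t ω|

/-- The moment condition `sup_t (1/m) ∑_i E|X_{t_i}² - E X_{t_i}²|^q ≤ (q!/2) σ² K^(q-2)` for all
integers `q ≥ 2`. -/
def MomentCondition (P : ∀ i, Measure (Ω i)) (X : T → ∀ i, Ω i → ℝ) (σ K : ℝ) : Prop :=
  ∀ q : ℕ, 2 ≤ q → ∀ t : T,
    (1 / (m : ℝ)) * ∑ i, ∫ x, |X t i x ^ 2 - ∫ y, X t i y ^ 2 ∂(P i)| ^ q ∂(P i)
      ≤ (q.factorial : ℝ) / 2 * σ ^ 2 * K ^ (q - 2)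

end Averages

end SupAverages

end

namespace SupAverages

/-! The unnormalised process `B_t = ∑ᵢ (X_{t_i}² - E X_{t_i}²)` (`centeredSum`) is bounded by
generic chaining along maps `π n : T → T` with at most `2^(2^n)` values. Chains start at level `ℓ =
⌊log₂ p⌋`: at most `2^p` points occur there, a maximum over so few costs only a constant factor in
`L^p`, and the moment condition produces the `σ` and `K` terms.

Let `D` bound the ψ₂-radius and let `s`, `t` be at distance `d`. Increments of `B` are only
subexponential: Bernstein gives `B_s - B_t` an `L^Q` norm of order `√(mQ) d D + Q d D`. For `Q ≤ m`
the first term dominates, and chaining costs `√m D γ₂` (`lintegral_centeredSum_sub_pow_le`). For `Q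
> m` the second term would lead to a `γ₁` functional. There one chains instead the Euclidean
distance `N` of the sample vectors, whose `L^(2r)` norm is at most of order `√r d` once `r ≥ m`
(`lintegral_sampleDist_pow_le`). At the switching level `k`, with `2^k` at least of order `m`,
`abs_centeredSum_le` bounds `|B_t|` by a multiple of `|B_{π_k t}| + N² + √m D N + m d D`. Since `N`
is of order `γ₂` and `√m d(t, π_k t)` is at most of order `γ₂`, this yields `γ₂² + √m D γ₂`.

Suprema are handled through moments: `exists_chain_ratio` supplies one random variable with bounded
`p`-th moment dominating all normalised links over a range of levels at once, after which summing
along a chain is deterministic. The tail bound is Markov's inequality with `p = u`. -/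

/-- The infima defining the ψ₂-norm and `γ₂` need not be attained, and a vanishing norm cannot be
divided by. Estimates are therefore proved for finite `L > a`, and `L` then decreases to `a`. -/
lemma le_of_forall_gt_of_continuous {x a : ℝ≥0∞} {f : ℝ≥0∞ → ℝ≥0∞} (hf : Continuous f)
    (ha : a ≠ ∞) (h : ∀ L : ℝ≥0, a < L → x ≤ f L) : x ≤ f a := by
  have hne : (nhdsWithin a (Set.Ioo a ∞)).NeBot := by
    rw [← mem_closure_iff_nhdsWithin_neBot, closure_Ioo ha]
    exact ⟨le_rfl, le_top⟩
  refine ge_of_tendsto (hf.continuousWithinAt (s := Set.Ioo a ∞) (x := a)) ?_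
  filter_upwards [self_mem_nhdsWithin] with L hL
  lift L to ℝ≥0 using hL.2.ne
  exact h L hL.1

lemma ennreal_add_pow_le (a b : ℝ≥0∞) (q : ℕ) :
    (a + b) ^ q ≤ 2 ^ (q - 1) * (a ^ q + b ^ q) := by
  rcases eq_or_ne q 0 with rfl | hq
  · simp
  induction a with
  | top => simp [hq]
  | coe a =>
    induction b with
    | top => simp [hq]
    | coe b => exact_mod_cast add_pow_le (zero_le (a := a)) (zero_le (a := b)) q

/-! ### The ψ₂-norm: triangle inequality and moment growth. -/

section PsiNorm

variable {Ω : Type*} [MeasurableSpace Ω] {P : Measure Ω} {X Y : Ω → ℝ}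

lemma psi_two_eq (x : ℝ) {C : ℝ} : psi 2 (|x| / C) = Real.exp ((x / C) ^ 2) - 1 := by
  rw [psi, Real.rpow_two, div_pow, div_pow, sq_abs]

lemma lintegral_psi_le_one {C : ℝ≥0} (hC : psiNorm 2 X P < C) :
    ∫⁻ ω, ENNReal.ofReal (Real.exp ((X ω / C) ^ 2) - 1) ∂P ≤ 1 := by
  obtain ⟨D, hD⟩ := iInf_lt_iff.1 hC
  obtain ⟨hD0, hD⟩ := iInf_lt_iff.1 hD
  obtain ⟨hI, hDC⟩ := iInf_lt_iff.1 hD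
  have hDC : D < C := by exact_mod_cast hDC
  refine le_trans (lintegral_mono fun ω => ?_) hI
  rw [psi_two_eq]
  refine ENNReal.ofReal_le_ofReal (sub_le_sub_right (Real.exp_le_exp.2 ?_) _)
  rw [div_pow, div_pow]
  have : (0 : ℝ) < D := hD0
  have : (D : ℝ) ≤ C := hDC.le
  gcongr

lemma psiNorm_le_of_lintegral_le_one {C : ℝ≥0} (hC : 0 < C)
    (h : ∫⁻ ω, ENNReal.ofReal (Real.exp ((X ω / C) ^ 2) - 1) ∂P ≤ 1) : psiNorm 2 X P ≤ C := by
  refine iInf_le_of_le C (iInf_le_of_le hC (iInf_le_of_le ?_ le_rfl))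
  simpa only [psi_two_eq] using h

lemma lintegral_exp_sq_le_two [IsProbabilityMeasure P] {C : ℝ≥0} (hC : psiNorm 2 X P < C) :
    ∫⁻ ω, ENNReal.ofReal (Real.exp ((X ω / C) ^ 2)) ∂P ≤ 2 := by
  calc ∫⁻ ω, ENNReal.ofReal (Real.exp ((X ω / C) ^ 2)) ∂P
      ≤ ∫⁻ ω, ENNReal.ofReal (Real.exp ((X ω / C) ^ 2) - 1) + 1 ∂P := by
        refine lintegral_mono fun ω => ?_
        rw [← ENNReal.ofReal_one, ← ENNReal.ofReal_add _ zero_le_one, sub_add_cancel]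
        exact sub_nonneg.2 (Real.one_le_exp (sq_nonneg _))
    _ = ∫⁻ ω, ENNReal.ofReal (Real.exp ((X ω / C) ^ 2) - 1) ∂P + 1 := by
        rw [lintegral_add_right _ measurable_const]; simp
    _ ≤ 1 + 1 := by gcongr; exact lintegral_psi_le_one hC
    _ = 2 := one_add_one_eq_two

lemma psiNorm_neg : psiNorm 2 (fun ω => -X ω) P = psiNorm 2 X P := by
  simp only [psiNorm, abs_neg]

lemma psiNorm_zero : psiNorm 2 (fun _ => (0 : ℝ)) P = 0 := by
  refine nonpos_iff_eq_zero.1 (le_of_forall_gt_of_continuous (f := id) continuous_id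
    ENNReal.zero_ne_top fun L hL => psiNorm_le_of_lintegral_le_one (by exact_mod_cast hL) ?_)
  simp

/-- Convexity of `x ↦ exp (x²)`: `(X + Y) / (a + b)` is the convex combination of `X / a` and `Y /
b` with weights `a / (a + b)` and `b / (a + b)`. -/
lemma psiNorm_add_le (hX : Measurable X) :
    psiNorm 2 (fun ω => X ω + Y ω) P ≤ psiNorm 2 X P + psiNorm 2 Y P := by
  rcases eq_or_ne (psiNorm 2 X P) ∞ with h | hX'
  · simp [h]
  rcases eq_or_ne (psiNorm 2 Y P) ∞ with h | hY'
  · simp [h]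
  refine le_of_forall_gt_of_continuous (f := fun a => a + psiNorm 2 Y P) (by fun_prop) hX'
    fun a ha => ?_
  refine le_of_forall_gt_of_continuous (f := fun b => a + b) (by fun_prop) hY'
    fun b hb => ?_
  have ha0 : (0 : ℝ) < a := by exact_mod_cast (zero_le (a := psiNorm 2 _ P)).trans_lt ha
  have hb0 : (0 : ℝ) < b := by exact_mod_cast (zero_le (a := psiNorm 2 _ P)).trans_lt hb
  rw [← ENNReal.coe_add]
  refine psiNorm_le_of_lintegral_le_one (by exact_mod_cast add_pos ha0 hb0) ?_
  have key : ∀ ω, Real.exp (((X ω + Y ω) / ((a + b : ℝ≥0) : ℝ)) ^ 2) - 1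
      ≤ a / (a + b) * (Real.exp ((X ω / a) ^ 2) - 1)
        + b / (a + b) * (Real.exp ((Y ω / b) ^ 2) - 1) := by
    intro ω
    have hs : (a : ℝ) / (a + b) + b / (a + b) = 1 := by field_simp
    have h1 : ((X ω + Y ω) / ((a + b : ℝ≥0) : ℝ)) ^ 2
        ≤ a / (a + b) * (X ω / a) ^ 2 + b / (a + b) * (Y ω / b) ^ 2 := by
      have := (even_two.convexOn_pow (𝕜 := ℝ)).2 (Set.mem_univ (X ω / a)) (Set.mem_univ (Y ω / b))
        (by positivity : (0 : ℝ) ≤ a / (a + b)) (by positivity : (0 : ℝ) ≤ b / (a + b)) hs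
      simp only [smul_eq_mul] at this
      refine le_of_eq_of_le ?_ this
      congr 1
      push_cast
      field_simp
    have h2 := convexOn_exp.2 (Set.mem_univ ((X ω / a) ^ 2)) (Set.mem_univ ((Y ω / b) ^ 2))
        (by positivity : (0 : ℝ) ≤ a / (a + b)) (by positivity : (0 : ℝ) ≤ b / (a + b)) hs
    simp only [smul_eq_mul] at h2
    have h3 := Real.exp_le_exp.2 h1
    linarith
  have hm : Measurable fun ω => ENNReal.ofReal (a / (a + b) * (Real.exp ((X ω / a) ^ 2) - 1)) := by
    fun_prop
  calc ∫⁻ ω, ENNReal.ofReal (Real.exp (((X ω + Y ω) / ((a + b : ℝ≥0) : ℝ)) ^ 2) - 1) ∂P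
      ≤ ∫⁻ ω, ENNReal.ofReal (a / (a + b) * (Real.exp ((X ω / a) ^ 2) - 1))
        + ENNReal.ofReal (b / (a + b) * (Real.exp ((Y ω / b) ^ 2) - 1)) ∂P :=
        lintegral_mono fun ω => (ENNReal.ofReal_le_ofReal (key ω)).trans ENNReal.ofReal_add_le
    _ = ENNReal.ofReal (a / (a + b)) * ∫⁻ ω, ENNReal.ofReal (Real.exp ((X ω / a) ^ 2) - 1) ∂P
        + ENNReal.ofReal (b / (a + b)) * ∫⁻ ω, ENNReal.ofReal (Real.exp ((Y ω / b) ^ 2) - 1) ∂P := by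
        rw [lintegral_add_left hm, ← lintegral_const_mul' _ _ ENNReal.ofReal_ne_top,
          ← lintegral_const_mul' _ _ ENNReal.ofReal_ne_top]
        simp_rw [ENNReal.ofReal_mul (show (0 : ℝ) ≤ a / (a + b) by positivity),
          ENNReal.ofReal_mul (show (0 : ℝ) ≤ b / (a + b) by positivity)]
    _ ≤ ENNReal.ofReal (a / (a + b)) * 1 + ENNReal.ofReal (b / (a + b)) * 1 := by
        gcongr
        · exact lintegral_psi_le_one ha
        · exact lintegral_psi_le_one hb
    _ = 1 := by
        rw [mul_one, mul_one, ← ENNReal.ofReal_add (by positivity) (by positivity), ← add_div,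
          div_self (by positivity), ENNReal.ofReal_one]

lemma psiNorm_sub_comm : psiNorm 2 (fun ω => X ω - Y ω) P = psiNorm 2 (fun ω => Y ω - X ω) P := by
  simp only [psiNorm, abs_sub_comm]

/-- Even moments are controlled by the `ψ₂`-norm. -/
lemma lintegral_pow_le_psiNorm (hX : psiNorm 2 X P ≠ ∞) {q : ℕ} (hq : 1 ≤ q) :
    ∫⁻ ω, ‖X ω‖ₑ ^ (2 * q) ∂P ≤ q.factorial * psiNorm 2 X P ^ (2 * q) := by
  refine le_of_forall_gt_of_continuous (f := fun a => q.factorial * a ^ (2 * q)) ?_ hX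
    fun C hC => ?_
  · exact (ENNReal.continuous_const_mul (by simp)).comp (ENNReal.continuous_pow _)
  have hC0 : (0 : ℝ) < C := by exact_mod_cast (zero_le (a := psiNorm 2 _ P)).trans_lt hC
  have key : ∀ ω, ‖X ω‖ₑ ^ (2 * q) ≤ (q.factorial * (C : ℝ≥0∞) ^ (2 * q)) *
      ENNReal.ofReal (Real.exp ((X ω / C) ^ 2) - 1) := by
    intro ω
    have h1 : ‖X ω‖ₑ ^ (2 * q) = ENNReal.ofReal (X ω ^ (2 * q)) := by
      rw [Real.enorm_eq_ofReal_abs, ← ENNReal.ofReal_pow (abs_nonneg _), pow_mul, sq_abs, ← pow_mul]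
    have h2 : (q.factorial * (C : ℝ≥0∞) ^ (2 * q)) = ENNReal.ofReal (q.factorial * C ^ (2 * q)) := by
      rw [ENNReal.ofReal_mul (by positivity), ENNReal.ofReal_pow (NNReal.coe_nonneg C), ENNReal.ofReal_natCast,
        ENNReal.ofReal_coe_nnreal]
    rw [h1, h2, ← ENNReal.ofReal_mul (by positivity)]
    refine ENNReal.ofReal_le_ofReal ?_
    -- Keeping the zeroth Taylor term besides the `q`-th lets `exp - 1`, whose integral is at most
    -- `1`, dominate; this needs `q ≥ 1`.
    have h3 : ((X ω / C) ^ 2) ^ q / q.factorial + 1 ≤ Real.exp ((X ω / C) ^ 2) := by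
      refine le_trans ?_ (Real.sum_le_exp_of_nonneg (sq_nonneg _) (q + 1))
      rw [Finset.sum_range_succ, add_comm]
      gcongr
      have := Finset.single_le_sum (f := fun i : ℕ => ((X ω / C) ^ 2) ^ i / (i.factorial : ℝ))
        (fun i _ => by positivity) (Finset.mem_range.2 hq)
      simpa using this
    calc X ω ^ (2 * q) = q.factorial * C ^ (2 * q) * (((X ω / C) ^ 2) ^ q / q.factorial) := by
          rw [← pow_mul, div_pow]; field_simp
      _ ≤ _ := by gcongr; linarith
  calc ∫⁻ ω, ‖X ω‖ₑ ^ (2 * q) ∂P ≤ _ := lintegral_mono key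
    _ = (q.factorial * (C : ℝ≥0∞) ^ (2 * q)) *
        ∫⁻ ω, ENNReal.ofReal (Real.exp ((X ω / C) ^ 2) - 1) ∂P :=
        lintegral_const_mul' _ _ (by finiteness)
    _ ≤ (q.factorial * (C : ℝ≥0∞) ^ (2 * q)) * 1 := by gcongr; exact lintegral_psi_le_one hC
    _ = _ := mul_one _

/-- Moments of a product of two subgaussian random variables. -/
lemma lintegral_mul_pow_le (hX : Measurable X) (hY : Measurable Y) {a b : ℝ≥0∞}
    (ha : psiNorm 2 X P ≤ a) (hb : psiNorm 2 Y P ≤ b) (ha' : a ≠ ∞) (hb' : b ≠ ∞)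
    {q : ℕ} (hq : 1 ≤ q) :
    ∫⁻ ω, ‖X ω * Y ω‖ₑ ^ q ∂P ≤ q.factorial * (a * b) ^ q := by
  -- Cauchy–Schwarz loses nothing here: the geometric mean of `q! a^(2q)` and `q! b^(2q)` is `q!
  -- (ab)^q`.
  have h := ENNReal.lintegral_mul_le_Lp_mul_Lq P Real.HolderConjugate.two_two
    (f := fun ω => ‖X ω‖ₑ ^ q) (g := fun ω => ‖Y ω‖ₑ ^ q) (by fun_prop) (by fun_prop)
  have hXq := (lintegral_pow_le_psiNorm (P := P) (ne_top_of_le_ne_top ha' ha) hq).trans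
    (mul_le_mul_right (pow_le_pow_left₀ (by simp) ha _) _)
  have hYq := (lintegral_pow_le_psiNorm (P := P) (ne_top_of_le_ne_top hb' hb) hq).trans
    (mul_le_mul_right (pow_le_pow_left₀ (by simp) hb _) _)
  have e : ∀ x : ℝ, (‖x‖ₑ ^ q) ^ (2 : ℝ) = ‖x‖ₑ ^ (2 * q) := fun x => by
    rw [ENNReal.rpow_two, ← pow_mul, mul_comm]
  simp only [Pi.mul_apply, ← mul_pow, ← enorm_mul, e] at h
  have sq : ∀ x : ℝ≥0∞, (x ^ 2) ^ (1 / 2 : ℝ) = x := fun x => by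
    rw [← ENNReal.rpow_two, ← ENNReal.rpow_mul]; norm_num
  calc ∫⁻ ω, ‖X ω * Y ω‖ₑ ^ q ∂P ≤ _ := h
    _ ≤ (q.factorial * a ^ (2 * q)) ^ (1 / 2 : ℝ) * (q.factorial * b ^ (2 * q)) ^ (1 / 2 : ℝ) := by
        gcongr
    _ = ((q.factorial * (a * b) ^ q) ^ 2) ^ (1 / 2 : ℝ) := by
        rw [← ENNReal.mul_rpow_of_nonneg _ _ (by norm_num)]
        congr 1; ring
    _ = _ := sq _

/-- Centering at most doubles the moment growth. -/
lemma lintegral_sub_integral_pow_le [IsProbabilityMeasure P] {κ : ℝ≥0∞}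
    (h : ∀ q : ℕ, 1 ≤ q → ∫⁻ ω, ‖X ω‖ₑ ^ q ∂P ≤ q.factorial * κ ^ q) {q : ℕ} (hq : 1 ≤ q) :
    ∫⁻ ω, ‖X ω - ∫ x, X x ∂P‖ₑ ^ q ∂P ≤ q.factorial * (2 * κ) ^ q := by
  have h1 : ‖∫ x, X x ∂P‖ₑ ≤ κ :=
    (enorm_integral_le_lintegral_enorm _).trans (by simpa using h 1 le_rfl)
  have hf : (1 : ℝ≥0∞) ≤ q.factorial := by exact_mod_cast q.factorial_pos
  calc ∫⁻ ω, ‖X ω - ∫ x, X x ∂P‖ₑ ^ q ∂P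
      ≤ ∫⁻ ω, 2 ^ (q - 1) * (‖X ω‖ₑ ^ q + κ ^ q) ∂P := by
        refine lintegral_mono fun ω => ?_
        calc ‖X ω - ∫ x, X x ∂P‖ₑ ^ q ≤ (‖X ω‖ₑ + κ) ^ q := by
              gcongr
              exact (enorm_sub_le).trans (by gcongr)
          _ ≤ _ := ennreal_add_pow_le _ _ q
    _ = 2 ^ (q - 1) * (∫⁻ ω, ‖X ω‖ₑ ^ q ∂P + κ ^ q) := by
        rw [lintegral_const_mul' _ _ (by finiteness), lintegral_add_right _ measurable_const]
        simp
    _ ≤ 2 ^ (q - 1) * (q.factorial * κ ^ q + q.factorial * κ ^ q) := by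
        gcongr
        · exact h q hq
        · exact le_mul_of_one_le_left (by simp) hf
    _ = q.factorial * (2 * κ) ^ q := by
        obtain ⟨r, rfl⟩ := Nat.exists_eq_add_of_le' hq
        simp only [Nat.add_sub_cancel]
        ring

end PsiNorm

/-- The remainder `exp x - 1 - x` as a series in the extended nonnegative numbers. -/
lemma ofReal_exp_sub_one_sub {x : ℝ} (hx : 0 ≤ x) :
    ENNReal.ofReal (Real.exp x - 1 - x)
      = ∑' q : ℕ, ENNReal.ofReal (x ^ (q + 2) / (q + 2).factorial) := by
  have h : HasSum (fun n : ℕ => x ^ n / n.factorial) (Real.exp x) := by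
    rw [Real.exp_eq_exp_ℝ]; exact NormedSpace.expSeries_div_hasSum_exp x
  have h2 := (hasSum_nat_add_iff' 2).2 h
  rw [← ENNReal.ofReal_tsum_of_nonneg (fun q => by positivity) h2.summable, h2.tsum_eq]
  congr 1
  simp [Finset.sum_range_succ]
  ring

/-! ### Laplace transforms and Bernstein moments of independent sums. -/

section Independent

variable {m : ℕ} {Ω : Fin m → Type*} [∀ i, MeasurableSpace (Ω i)] {P : ∀ i, Measure (Ω i)}
  [∀ i, IsProbabilityMeasure (P i)]

lemma lintegral_exp_sum_le {f : ∀ i, Ω i → ℝ} {M : Fin m → ℝ}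
    (hf : ∀ i, Integrable (fun x => Real.exp (f i x)) (P i))
    (hM : ∀ i, ∫ x, Real.exp (f i x) ∂(P i) ≤ M i) :
    ∫⁻ ω, ENNReal.ofReal (Real.exp (∑ i, f i (ω i))) ∂(Measure.pi P)
      ≤ ENNReal.ofReal (∏ i, M i) := by
  simp_rw [Real.exp_sum]
  rw [← ofReal_integral_eq_lintegral_ofReal (Integrable.fintype_prod_dep hf)
    (ae_of_all _ fun ω => by positivity)]
  refine ENNReal.ofReal_le_ofReal ?_
  rw [integral_fintype_prod_eq_prod (fun i x => Real.exp (f i x))]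
  exact Finset.prod_le_prod (fun i _ => integral_nonneg fun x => (Real.exp_pos _).le)
    fun i _ => hM i

/-- A Laplace transform bound for a centered random variable in terms of the exponential
remainder. -/
lemma integral_exp_le {α : Type*} [MeasurableSpace α] {μ : Measure α} [IsProbabilityMeasure μ]
    {Y : α → ℝ} (hYm : Measurable Y) (hY : Integrable Y μ) (hY0 : ∫ x, Y x ∂μ = 0)
    (h : ∫⁻ x, ENNReal.ofReal (Real.exp |Y x| - 1 - |Y x|) ∂μ ≠ ∞) :
    Integrable (fun x => Real.exp (Y x)) μ ∧
      ∫ x, Real.exp (Y x) ∂μ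
        ≤ Real.exp (∫⁻ x, ENNReal.ofReal (Real.exp |Y x| - 1 - |Y x|) ∂μ).toReal := by
  have hnn : ∀ x, 0 ≤ Real.exp |Y x| - 1 - |Y x| := fun x => by
    linarith [Real.add_one_le_exp |Y x|]
  have hm : Measurable fun x => Real.exp |Y x| - 1 - |Y x| := by fun_prop
  have hint : Integrable (fun x => Real.exp |Y x| - 1 - |Y x|) μ := by
    refine ⟨hm.aestronglyMeasurable, ?_⟩
    rw [hasFiniteIntegral_iff_ofReal (ae_of_all _ hnn)]
    exact h.lt_top
  have hI : (∫⁻ x, ENNReal.ofReal (Real.exp |Y x| - 1 - |Y x|) ∂μ).toReal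
      = ∫ x, (Real.exp |Y x| - 1 - |Y x|) ∂μ :=
    (integral_eq_lintegral_of_nonneg_ae (ae_of_all _ hnn) hm.aestronglyMeasurable).symm
  -- For `Y x = -z ≤ 0` this is the inequality `z ≤ sinh z`. Centering removes the linear term after
  -- integration.
  have hle : ∀ x, Real.exp (Y x) ≤ (1 + Y x) + (Real.exp |Y x| - 1 - |Y x|) := fun x => by
    rcases le_total 0 (Y x) with hx | hx
    · rw [abs_of_nonneg hx]; linarith
    · rw [abs_of_nonpos hx]
      have h1 := Real.self_le_sinh_iff.2 (neg_nonneg.2 hx)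
      rw [Real.sinh_eq, neg_neg] at h1
      linarith
  have hint2 : Integrable (fun x => (1 + Y x) + (Real.exp |Y x| - 1 - |Y x|)) μ :=
    ((integrable_const _).add hY).add hint
  have hexp : Integrable (fun x => Real.exp (Y x)) μ := by
    refine hint2.mono (by fun_prop) (ae_of_all _ fun x => ?_)
    rw [Real.norm_of_nonneg (Real.exp_pos _).le]
    exact (hle x).trans (le_abs_self _)
  refine ⟨hexp, ?_⟩
  rw [hI]
  calc ∫ x, Real.exp (Y x) ∂μ ≤ ∫ x, ((1 + Y x) + (Real.exp |Y x| - 1 - |Y x|)) ∂μ :=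
        integral_mono hexp hint2 hle
    _ = 1 + ∫ x, (Real.exp |Y x| - 1 - |Y x|) ∂μ := by
        have h1 : Integrable (fun x => 1 + Y x) μ := (integrable_const _).add hY
        rw [integral_add h1 hint,
          integral_add (integrable_const _) hY, hY0]
        simp
    _ ≤ _ := by rw [add_comm]; exact Real.add_one_le_exp _

/-- Tonelli for a nonnegative series: finiteness of the exponential moment is not assumed but
follows from moment bounds of order at least two. -/
lemma lintegral_exp_remainder_eq {α : Type*} [MeasurableSpace α] {μ : Measure α}
    {Y : α → ℝ} (hYm : Measurable Y) {L : ℝ≥0} (hL : 0 < L) :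
    ∫⁻ x, ENNReal.ofReal (Real.exp |Y x / L| - 1 - |Y x / L|) ∂μ
      = ∑' q : ℕ, ((L : ℝ≥0∞) ^ (q + 2) * (q + 2).factorial)⁻¹ * ∫⁻ x, ‖Y x‖ₑ ^ (q + 2) ∂μ := by
  have e : ∀ x, ENNReal.ofReal (Real.exp |Y x / L| - 1 - |Y x / L|)
      = ∑' q : ℕ, ((L : ℝ≥0∞) ^ (q + 2) * (q + 2).factorial)⁻¹ * ‖Y x‖ₑ ^ (q + 2) := fun x => by
    rw [ofReal_exp_sub_one_sub (abs_nonneg _)]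
    refine tsum_congr fun q => ?_
    have hL' : (0 : ℝ) < L := hL
    have h1 : (L : ℝ≥0∞) ^ (q + 2) * (q + 2).factorial
        = ENNReal.ofReal (L ^ (q + 2) * (q + 2).factorial) := by
      rw [ENNReal.ofReal_mul (by positivity), ENNReal.ofReal_pow hL'.le, ENNReal.ofReal_natCast,
        ENNReal.ofReal_coe_nnreal]
    rw [h1, Real.enorm_eq_ofReal_abs, ← ENNReal.ofReal_pow (abs_nonneg _),
      ← ENNReal.ofReal_inv_of_pos (by positivity), ← ENNReal.ofReal_mul (by positivity),
      abs_div, abs_of_pos hL', div_pow]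
    congr 1
    field_simp
  simp_rw [e]
  rw [lintegral_tsum fun q => by fun_prop]
  refine tsum_congr fun q => lintegral_const_mul _ (by fun_prop)

/-- Moment form of Bernstein's inequality: a centered independent sum whose summands satisfy a
factorial moment bound. -/
lemma lintegral_sum_pow_le {Y : ∀ i, Ω i → ℝ} (hYm : ∀ i, Measurable (Y i))
    (hY : ∀ i, Integrable (Y i) (P i)) (hY0 : ∀ i, ∫ x, Y i x ∂(P i) = 0) {v K : ℝ≥0}
    (h : ∀ q : ℕ, ∑ i, ∫⁻ x, ‖Y i x‖ₑ ^ (q + 2) ∂(P i)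
      ≤ (q + 2).factorial * ((v : ℝ≥0∞) * (K : ℝ≥0∞) ^ q))
    {Q : ℕ} (hQ : 1 ≤ Q) {L : ℝ≥0} (hL : 0 < L) (hKL : 2 * K ≤ L) (hvL : v ≤ Q * L ^ 2) :
    ∫⁻ ω, ‖∑ i, Y i (ω i)‖ₑ ^ Q ∂(Measure.pi P) ≤ (16 * Q * (L : ℝ≥0∞)) ^ Q := by
  have hL' : (0 : ℝ) < L := hL
  have hLt : (L : ℝ≥0∞) ≠ 0 := by exact_mod_cast hL.ne'
  -- The factorials cancel, leaving a geometric series with ratio `K / L ≤ 1/2` and first term `v /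
  -- L² ≤ Q`. So `L` is chosen to make the Laplace exponent comparable to `Q`.
  have hrem : ∑ i, ∫⁻ x, ENNReal.ofReal (Real.exp |Y i x / L| - 1 - |Y i x / L|) ∂(P i)
      ≤ 2 * Q := by
    simp_rw [lintegral_exp_remainder_eq (hYm _) hL]
    rw [← Summable.tsum_finsetSum fun i _ => ENNReal.summable]
    calc ∑' q : ℕ, ∑ i, ((L : ℝ≥0∞) ^ (q + 2) * (q + 2).factorial)⁻¹ *
          ∫⁻ x, ‖Y i x‖ₑ ^ (q + 2) ∂(P i)
        ≤ ∑' q : ℕ, Q * (2⁻¹ : ℝ≥0∞) ^ q := by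
          refine ENNReal.tsum_le_tsum fun q => ?_
          rw [← Finset.mul_sum]
          calc _ ≤ ((L : ℝ≥0∞) ^ (q + 2) * (q + 2).factorial)⁻¹ *
                ((q + 2).factorial * ((v : ℝ≥0∞) * (K : ℝ≥0∞) ^ q)) := by gcongr; exact h q
            _ ≤ ((L : ℝ≥0∞) ^ (q + 2) * (q + 2).factorial)⁻¹ *
                ((L : ℝ≥0∞) ^ (q + 2) * (q + 2).factorial * (Q * (2⁻¹ : ℝ≥0∞) ^ q)) := by
                refine mul_le_mul' le_rfl ?_
                have h1 : (v : ℝ≥0∞) ≤ Q * (L : ℝ≥0∞) ^ 2 := by exact_mod_cast hvL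
                have h2 : (K : ℝ≥0∞) ≤ 2⁻¹ * L := by
                  have : (2 : ℝ≥0∞) * K ≤ L := by exact_mod_cast hKL
                  rw [mul_comm, ← div_eq_mul_inv]
                  exact ENNReal.le_div_iff_mul_le (by simp) (by simp) |>.2 (by rwa [mul_comm])
                calc ((q + 2).factorial : ℝ≥0∞) * ((v : ℝ≥0∞) * (K : ℝ≥0∞) ^ q)
                    ≤ (q + 2).factorial * ((Q * (L : ℝ≥0∞) ^ 2) * (2⁻¹ * L) ^ q) := by gcongr
                  _ = _ := by rw [mul_pow]; ring
            _ = Q * (2⁻¹ : ℝ≥0∞) ^ q := by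
                rw [← mul_assoc, ENNReal.inv_mul_cancel, one_mul]
                · simp [hLt, Nat.factorial_ne_zero]
                · finiteness
      _ = 2 * Q := by rw [ENNReal.tsum_mul_left, ENNReal.tsum_geometric_two, mul_comm]
  have hfin : ∀ i, ∫⁻ x, ENNReal.ofReal (Real.exp |Y i x / L| - 1 - |Y i x / L|) ∂(P i) ≠ ∞ :=
    fun i => ne_top_of_le_ne_top (by finiteness)
      ((Finset.single_le_sum (fun _ _ => zero_le) (Finset.mem_univ i)).trans hrem)
  have hsum : ∑ i, (∫⁻ x, ENNReal.ofReal (Real.exp |Y i x / L| - 1 - |Y i x / L|) ∂(P i)).toReal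
      ≤ 2 * Q := by
    rw [← ENNReal.toReal_sum fun i _ => hfin i]
    exact ENNReal.toReal_le_of_le_ofReal (by positivity) (hrem.trans (by
      rw [ENNReal.ofReal_mul (by norm_num)]; simp))
  have laplace : ∀ s : ℝ, |s| = 1 →
      ∫⁻ ω, ENNReal.ofReal (Real.exp (s * ((∑ i, Y i (ω i)) / L))) ∂(Measure.pi P)
        ≤ ENNReal.ofReal (Real.exp (2 * Q)) := by
    intro s hs
    have e : ∀ ω : ∀ i, Ω i, s * ((∑ i, Y i (ω i)) / L) = ∑ i, s * (Y i (ω i) / L) := fun ω => by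
      rw [Finset.sum_div, Finset.mul_sum]
    have habs : ∀ i x, |s * (Y i x / L)| = |Y i x / L| := fun i x => by rw [abs_mul, hs, one_mul]
    have hi : ∀ i, _ := fun i => integral_exp_le (μ := P i) (Y := fun x => s * (Y i x / L))
      (by fun_prop) (((hY i).div_const _).const_mul _)
      (by rw [integral_const_mul, integral_div, hY0]; simp) (by simpa only [habs] using hfin i)
    simp only [habs] at hi
    simp_rw [e]
    refine (lintegral_exp_sum_le (fun i => (hi i).1) fun i => (hi i).2).trans ?_
    rw [← Real.exp_sum]
    exact ENNReal.ofReal_le_ofReal (Real.exp_le_exp.2 hsum)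
  have key : ∀ ω : ∀ i, Ω i, ‖∑ i, Y i (ω i)‖ₑ ^ Q ≤ (Q.factorial * (L : ℝ≥0∞) ^ Q) *
      (ENNReal.ofReal (Real.exp (1 * ((∑ i, Y i (ω i)) / L)))
        + ENNReal.ofReal (Real.exp (-1 * ((∑ i, Y i (ω i)) / L)))) := by
    intro ω
    set S := ∑ i, Y i (ω i)
    have h2 : (Q.factorial * (L : ℝ≥0∞) ^ Q) = ENNReal.ofReal (Q.factorial * L ^ Q) := by
      rw [ENNReal.ofReal_mul (by positivity), ENNReal.ofReal_pow hL'.le, ENNReal.ofReal_natCast,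
        ENNReal.ofReal_coe_nnreal]
    rw [h2, ← ENNReal.ofReal_add (by positivity) (by positivity),
      ← ENNReal.ofReal_mul (by positivity), Real.enorm_eq_ofReal_abs,
      ← ENNReal.ofReal_pow (abs_nonneg _)]
    refine ENNReal.ofReal_le_ofReal ?_
    have h3 := Real.pow_div_factorial_le_exp (x := |S / L|) (abs_nonneg _) Q
    have h4 : Real.exp |S / L| ≤ Real.exp (1 * (S / L)) + Real.exp (-1 * (S / L)) := by
      rw [one_mul, neg_one_mul]
      exact Real.exp_abs_le _
    calc |S| ^ Q = Q.factorial * L ^ Q * (|S / L| ^ Q / Q.factorial) := by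
          rw [abs_div, abs_of_pos hL', div_pow]; field_simp
      _ ≤ _ := by gcongr; exact h3.trans h4
  calc ∫⁻ ω, ‖∑ i, Y i (ω i)‖ₑ ^ Q ∂(Measure.pi P) ≤ _ := lintegral_mono key
    _ = (Q.factorial * (L : ℝ≥0∞) ^ Q) *
        (∫⁻ ω, ENNReal.ofReal (Real.exp (1 * ((∑ i, Y i (ω i)) / L))) ∂(Measure.pi P)
        + ∫⁻ ω, ENNReal.ofReal (Real.exp (-1 * ((∑ i, Y i (ω i)) / L))) ∂(Measure.pi P)) := by
        rw [lintegral_const_mul' _ _ (by finiteness), lintegral_add_left (by fun_prop)]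
    _ ≤ (Q.factorial * (L : ℝ≥0∞) ^ Q) *
        (ENNReal.ofReal (Real.exp (2 * Q)) + ENNReal.ofReal (Real.exp (2 * Q))) := by
        gcongr
        · exact laplace 1 (by simp)
        · exact laplace (-1) (by simp)
    _ ≤ (Q ^ Q * (L : ℝ≥0∞) ^ Q) * (16 ^ Q) := by
        gcongr
        · exact_mod_cast Q.factorial_le_pow
        · rw [← ENNReal.ofReal_add (by positivity) (by positivity)]
          -- `e² < 8`, and the factor `2` from the two signs is at most `2^Q`; together they give
          -- `16^Q`.
          have : Real.exp (2 * Q) ≤ 8 ^ Q := by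
            have h1 : Real.exp (2 * Q) = (Real.exp 1) ^ (2 * Q) := by
              rw [← Real.exp_nat_mul]; push_cast; ring_nf
            rw [h1, pow_mul]
            gcongr
            nlinarith [Real.exp_one_lt_d9, Real.exp_pos 1]
          have h2 : (2 : ℝ) ≤ 2 ^ Q := by
            simpa using pow_le_pow_right₀ (one_le_two (α := ℝ)) hQ
          have h3 : Real.exp (2 * Q) + Real.exp (2 * Q) ≤ 16 ^ Q := by
            rw [show (16 : ℝ) = 2 * 8 by norm_num, mul_pow]
            have : (0 : ℝ) ≤ 8 ^ Q := by positivity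
            nlinarith
          refine (ENNReal.ofReal_le_ofReal h3).trans ?_
          rw [ENNReal.ofReal_pow (by norm_num)]
          simp
    _ = _ := by rw [mul_pow, mul_pow]; ring

end Independent

/-! ### Squares of subgaussian variables and their differences. -/

section Moments

variable {Ω : Type*} [MeasurableSpace Ω] {P : Measure Ω} {X Y : Ω → ℝ}

lemma integrable_of_lintegral_enorm_le (hX : Measurable X) {κ : ℝ≥0∞} (hκ : κ ≠ ∞)
    (h : ∫⁻ ω, ‖X ω‖ₑ ∂P ≤ κ) : Integrable X P :=
  ⟨hX.aestronglyMeasurable, h.trans_lt hκ.lt_top⟩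

lemma lintegral_sq_pow_le (hX : Measurable X) {a : ℝ≥0∞} (ha : psiNorm 2 X P ≤ a) (ha' : a ≠ ∞)
    {q : ℕ} (hq : 1 ≤ q) :
    ∫⁻ ω, ‖X ω ^ 2‖ₑ ^ q ∂P ≤ q.factorial * (a ^ 2) ^ q := by
  simpa only [← sq] using lintegral_mul_pow_le hX hX ha ha ha' ha' hq

lemma integrable_sq (hX : Measurable X) {a : ℝ≥0∞} (ha : psiNorm 2 X P ≤ a) (ha' : a ≠ ∞) :
    Integrable (fun ω => X ω ^ 2) P :=
  integrable_of_lintegral_enorm_le (by fun_prop) (κ := a ^ 2) (by finiteness)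
    (by simpa using lintegral_sq_pow_le hX ha ha' le_rfl)

lemma integral_sq_le (hX : Measurable X) {a : ℝ≥0} (ha : psiNorm 2 X P ≤ a) :
    ∫ ω, X ω ^ 2 ∂P ≤ a ^ 2 := by
  have h := lintegral_sq_pow_le hX ha ENNReal.coe_ne_top le_rfl
  have h2 := (enorm_integral_le_lintegral_enorm (μ := P) (fun ω => X ω ^ 2)).trans
    (by simpa using h)
  rw [← enorm_norm, Real.enorm_eq_ofReal_abs, ← ENNReal.coe_pow, ← ENNReal.ofReal_coe_nnreal] at h2
  have h3 := (ENNReal.ofReal_le_ofReal_iff (NNReal.coe_nonneg _)).1 h2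
  rw [abs_norm] at h3
  exact (le_abs_self _).trans (by exact_mod_cast h3)

/-- The factorisation `(X - Y) * (X + Y)` makes the subexponential scale linear in `d`, the second
factor having ψ₂-norm at most `2 * D`. -/
lemma lintegral_sq_sub_sq_pow_le (hX : Measurable X) (hY : Measurable Y) {d D : ℝ≥0}
    (hd : psiNorm 2 (fun ω => X ω - Y ω) P ≤ d) (hXD : psiNorm 2 X P ≤ D)
    (hYD : psiNorm 2 Y P ≤ D) {q : ℕ} (hq : 1 ≤ q) :
    ∫⁻ ω, ‖X ω ^ 2 - Y ω ^ 2‖ₑ ^ q ∂P ≤ q.factorial * ((d : ℝ≥0∞) * (2 * D)) ^ q := by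
  have h : psiNorm 2 (fun ω => X ω + Y ω) P ≤ 2 * D := by
    rw [two_mul]
    exact (psiNorm_add_le hX).trans (add_le_add hXD hYD)
  have := lintegral_mul_pow_le (P := P) (X := fun ω => X ω - Y ω) (Y := fun ω => X ω + Y ω)
    (by fun_prop) (by fun_prop) hd h (by finiteness) (by finiteness) hq
  refine le_of_eq_of_le (lintegral_congr fun ω => ?_) this
  congr 2
  ring

lemma abs_integral_sq_sub_sq_le (hX : Measurable X) (hY : Measurable Y) {d D : ℝ≥0}
    (hd : psiNorm 2 (fun ω => X ω - Y ω) P ≤ d) (hXD : psiNorm 2 X P ≤ D)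
    (hYD : psiNorm 2 Y P ≤ D) :
    |∫ ω, X ω ^ 2 ∂P - ∫ ω, Y ω ^ 2 ∂P| ≤ d * (2 * D) := by
  rw [← integral_sub (integrable_sq hX hXD (by finiteness)) (integrable_sq hY hYD (by finiteness))]
  have h := lintegral_sq_sub_sq_pow_le hX hY hd hXD hYD le_rfl
  have h2 := (enorm_integral_le_lintegral_enorm (μ := P) (fun ω => X ω ^ 2 - Y ω ^ 2)).trans
    (by simpa using h)
  have e : (d : ℝ≥0∞) * (2 * D) = ((d * (2 * D) : ℝ≥0) : ℝ≥0∞) := by push_cast; rfl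
  rw [Real.enorm_eq_ofReal_abs, e, ← ENNReal.ofReal_coe_nnreal] at h2
  have h3 := (ENNReal.ofReal_le_ofReal_iff (NNReal.coe_nonneg _)).1 h2
  exact_mod_cast h3

end Moments

/-! ### Moments of the quadratic process and of the sample distance. -/

section QuadraticProcess

variable {m : ℕ} {Ω : Fin m → Type*} {T : Type*}

/-- The Euclidean distance between the sample vectors of two indices. -/
noncomputable def sampleDist (X : T → ∀ i, Ω i → ℝ) (s t : T) (ω : ∀ i, Ω i) : ℝ :=
  √(∑ i, (X s i (ω i) - X t i (ω i)) ^ 2)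

/-- This identification supplies the triangle inequality for telescoping along chains. -/
lemma sampleDist_eq_dist (X : T → ∀ i, Ω i → ℝ) (s t : T) (ω : ∀ i, Ω i) :
    sampleDist X s t ω = dist (WithLp.toLp 2 fun i => X s i (ω i)) (WithLp.toLp 2 fun i =>
      X t i (ω i)) := by
  rw [EuclideanSpace.dist_eq, sampleDist]
  simp [Real.dist_eq]

lemma sampleDist_nonneg (X : T → ∀ i, Ω i → ℝ) (s t : T) (ω : ∀ i, Ω i) :
    0 ≤ sampleDist X s t ω := Real.sqrt_nonneg _

variable [∀ i, MeasurableSpace (Ω i)]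

/-- The unnormalized sum of centered squares `∑_i (X_{t_i}² - E X_{t_i}²)`. -/
noncomputable def centeredSum (P : ∀ i, Measure (Ω i)) (X : T → ∀ i, Ω i → ℝ) (t : T) (ω : ∀ i, Ω i) : ℝ :=
  ∑ i, (X t i (ω i) ^ 2 - ∫ x, X t i x ^ 2 ∂(P i))

variable {P : ∀ i, Measure (Ω i)} {X : T → ∀ i, Ω i → ℝ}

lemma measurable_centeredSum (hX : ∀ t i, Measurable (X t i)) (t : T) :
    Measurable (centeredSum P X t) :=
  Finset.measurable_sum _ fun i _ =>
    (((hX t i).comp (measurable_pi_apply i)).pow_const 2).sub_const _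

lemma measurable_sampleDist (hX : ∀ t i, Measurable (X t i)) (s t : T) :
    Measurable (sampleDist X s t) :=
  (Finset.measurable_sum _ fun i _ => (((hX s i).comp (measurable_pi_apply i)).sub
    ((hX t i).comp (measurable_pi_apply i))).pow_const 2).sqrt

/-- The quadratic process is controlled by its value at another index and by the Euclidean
distance of the sample vectors. -/
lemma abs_centeredSum_le {s t : T} {d D : ℝ≥0} (hX : ∀ t i, Measurable (X t i))
    (hd : ∀ i, psiNorm 2 (fun x => X s i x - X t i x) (P i) ≤ d)
    (hs : ∀ i, psiNorm 2 (X s i) (P i) ≤ D) (ht : ∀ i, psiNorm 2 (X t i) (P i) ≤ D)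
    (ω : ∀ i, Ω i) :
    |centeredSum P X s ω| ≤ 2 * |centeredSum P X t ω| + 2 * sampleDist X s t ω ^ 2
      + 2 * √m * D * sampleDist X s t ω + 2 * m * d * D := by
  set N := sampleDist X s t ω with hN
  have hN0 : 0 ≤ N := sampleDist_nonneg X s t ω
  have hN2 : N ^ 2 = ∑ i, (X s i (ω i) - X t i (ω i)) ^ 2 :=
    Real.sq_sqrt (Finset.sum_nonneg fun i _ => sq_nonneg _)
  set W := √(∑ i, X t i (ω i) ^ 2) with hW
  have hW0 : 0 ≤ W := Real.sqrt_nonneg _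
  have hW2 : W ^ 2 = ∑ i, X t i (ω i) ^ 2 :=
    Real.sq_sqrt (Finset.sum_nonneg fun i _ => sq_nonneg _)
  have hCS : |∑ i, (X s i (ω i) - X t i (ω i)) * X t i (ω i)| ≤ N * W := by
    refine Real.abs_le_sqrt (Finset.sum_mul_sq_le_sq_mul_sq _ _ _) |>.trans ?_
    rw [Real.sqrt_mul (Finset.sum_nonneg fun i _ => sq_nonneg _)]
    rfl
  -- The length of the sample vector of `t` is itself controlled by the process at `t`, since `W²`
  -- is the centered sum plus its mean.
  have hWB : W ^ 2 ≤ |centeredSum P X t ω| + m * D ^ 2 := by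
    have h1 : W ^ 2 = centeredSum P X t ω + ∑ i, ∫ x, X t i x ^ 2 ∂(P i) := by
      rw [hW2, centeredSum, Finset.sum_sub_distrib]; ring
    have h2 : ∑ i, ∫ x, X t i x ^ 2 ∂(P i) ≤ m * D ^ 2 := by
      refine (Finset.sum_le_sum fun i _ => integral_sq_le (hX t i) (ht i)).trans ?_
      simp
    linarith [le_abs_self (centeredSum P X t ω)]
  have hWle : W ≤ √|centeredSum P X t ω| + √m * D := by
    refine (pow_le_pow_iff_left₀ hW0 (by positivity) two_ne_zero).1 (hWB.trans ?_)
    have h1 : 0 ≤ 2 * √|centeredSum P X t ω| * (√m * D) := by positivity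
    have h2 : (√m * D) ^ 2 = m * (D : ℝ) ^ 2 := by rw [mul_pow, Real.sq_sqrt (by positivity)]
    rw [add_sq, h2, Real.sq_sqrt (abs_nonneg _)]
    linarith
  -- The cross term `2 N √|B_t|` is absorbed as `N² + |B_t|`, which produces the factors `2` in the
  -- conclusion.
  have hNW : 2 * (N * W) ≤ N ^ 2 + |centeredSum P X t ω| + 2 * √m * D * N := by
    have h1 := mul_le_mul_of_nonneg_left hWle hN0
    have h2 := two_mul_le_add_sq N √|centeredSum P X t ω|
    rw [Real.sq_sqrt (abs_nonneg _)] at h2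
    linarith
  have hE : |∑ i, (∫ x, X s i x ^ 2 ∂(P i) - ∫ x, X t i x ^ 2 ∂(P i))| ≤ m * (d * (2 * D)) := by
    refine (Finset.abs_sum_le_sum_abs _ _).trans
      ((Finset.sum_le_sum fun i _ =>
        abs_integral_sq_sub_sq_le (hX s i) (hX t i) (hd i) (hs i) (ht i)).trans ?_)
    simp
  have hdec : centeredSum P X s ω = centeredSum P X t ω + N ^ 2
      + 2 * ∑ i, (X s i (ω i) - X t i (ω i)) * X t i (ω i)
      - ∑ i, (∫ x, X s i x ^ 2 ∂(P i) - ∫ x, X t i x ^ 2 ∂(P i)) := by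
    rw [hN2, centeredSum, centeredSum, Finset.mul_sum, ← Finset.sum_add_distrib,
      ← Finset.sum_add_distrib, ← Finset.sum_sub_distrib]
    exact Finset.sum_congr rfl fun i _ => by ring
  rw [hdec]
  obtain ⟨hC1, hC2⟩ := abs_le.1 hCS
  obtain ⟨hE1, hE2⟩ := abs_le.1 hE
  rw [abs_le]
  constructor
  · linarith [neg_abs_le (centeredSum P X t ω), sq_nonneg N]
  · linarith [le_abs_self (centeredSum P X t ω)]

variable [∀ i, IsProbabilityMeasure (P i)]

/-- Bernstein-type moments of increments of the quadratic process. -/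
lemma lintegral_centeredSum_sub_pow_le {s t : T} {d D : ℝ≥0} (hX : ∀ t i, Measurable (X t i))
    (hd : ∀ i, psiNorm 2 (fun x => X s i x - X t i x) (P i) ≤ d)
    (hs : ∀ i, psiNorm 2 (X s i) (P i) ≤ D) (ht : ∀ i, psiNorm 2 (X t i) (P i) ≤ D)
    {Q : ℕ} (hQ : 1 ≤ Q) (hQm : Q ≤ m) :
    ∫⁻ ω, ‖centeredSum P X s ω - centeredSum P X t ω‖ₑ ^ Q ∂(Measure.pi P)
      ≤ (128 * ((d * D * NNReal.sqrt m * NNReal.sqrt Q : ℝ≥0) : ℝ≥0∞)) ^ Q := by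
  set κ : ℝ≥0 := d * (2 * D) with hκ
  -- With variance `4mκ²` and scale `2κ`, the choice `L = 4κr` meets both requirements of the
  -- Bernstein bound: `r ≥ 1` since `Q ≤ m`, and `Q r² = m`. This is the subgaussian regime.
  set r : ℝ≥0 := NNReal.sqrt (m / Q) with hr
  have hQ0 : (0 : ℝ≥0) < Q := by exact_mod_cast hQ
  have hr1 : 1 ≤ r := by
    rw [hr, NNReal.le_sqrt_iff_sq_le, one_pow]
    exact (one_le_div hQ0).2 (by exact_mod_cast hQm)
  have hr2 : Q * r ^ 2 = m := by
    rw [hr, NNReal.sq_sqrt]; field_simp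
  have hQr : Q * r = NNReal.sqrt m * NNReal.sqrt Q := by
    rw [← hr2, NNReal.sqrt_mul, NNReal.sqrt_sq]
    nth_rw 1 [← NNReal.mul_self_sqrt (Q : ℝ≥0)]
    ring
  set Y : ∀ i, Ω i → ℝ := fun i x => (X s i x ^ 2 - X t i x ^ 2)
    - ∫ x, (X s i x ^ 2 - X t i x ^ 2) ∂(P i) with hY
  have hZ : ∀ i (q : ℕ), 1 ≤ q → ∫⁻ x, ‖X s i x ^ 2 - X t i x ^ 2‖ₑ ^ q ∂(P i)
      ≤ q.factorial * (κ : ℝ≥0∞) ^ q := fun i q hq => by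
    have := lintegral_sq_sub_sq_pow_le (hX s i) (hX t i) (hd i) (hs i) (ht i) hq
    rw [hκ]; push_cast; exact this
  have hZm : ∀ i, Measurable fun x => X s i x ^ 2 - X t i x ^ 2 := fun i =>
    ((hX s i).pow_const 2).sub ((hX t i).pow_const 2)
  have hZi : ∀ i, Integrable (fun x => X s i x ^ 2 - X t i x ^ 2) (P i) := fun i =>
    integrable_of_lintegral_enorm_le (hZm i) (κ := κ) (by finiteness)
      (by simpa using hZ i 1 le_rfl)
  have hsum : ∀ ω : ∀ i, Ω i, centeredSum P X s ω - centeredSum P X t ω = ∑ i, Y i (ω i) := by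
    intro ω
    rw [centeredSum, centeredSum, ← Finset.sum_sub_distrib]
    refine Finset.sum_congr rfl fun i _ => ?_
    rw [hY]
    dsimp only
    rw [integral_sub (integrable_sq (hX s i) (hs i) (by finiteness))
      (integrable_sq (hX t i) (ht i) (by finiteness))]
    ring
  have hbound : ∀ L : ℝ≥0, ((4 * κ * r : ℝ≥0) : ℝ≥0∞) < L →
      ∫⁻ ω, ‖centeredSum P X s ω - centeredSum P X t ω‖ₑ ^ Q ∂(Measure.pi P)
        ≤ (16 * Q * (L : ℝ≥0∞)) ^ Q := by
    intro L hL
    have hL : 4 * κ * r < L := by exact_mod_cast hL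
    simp_rw [hsum]
    have hY0 : ∀ i, ∫ x, Y i x ∂(P i) = 0 := fun i => by
      rw [hY]
      dsimp only
      rw [integral_sub (hZi i) (integrable_const _)]
      simp
    have hYm : ∀ i, Measurable (Y i) := fun i => (hZm i).sub_const _
    have hYi : ∀ i, Integrable (Y i) (P i) := fun i => (hZi i).sub (integrable_const _)
    clear_value Y
    refine lintegral_sum_pow_le (Y := Y) (v := 4 * m * κ ^ 2) (K := 2 * κ) hYm hYi hY0
      (fun q => ?_) hQ (zero_le.trans_lt hL) ?_ ?_
    · have hc : ∀ i, ∫⁻ x, ‖Y i x‖ₑ ^ (q + 2) ∂(P i)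
          ≤ (q + 2).factorial * (2 * (κ : ℝ≥0∞)) ^ (q + 2) := fun i => by
        simp only [hY]
        exact lintegral_sub_integral_pow_le (hZ i) (Nat.le_add_left 1 (q + 1))
      refine (Finset.sum_le_sum fun i _ => hc i).trans (le_of_eq ?_)
      rw [Finset.sum_const, Finset.card_univ, Fintype.card_fin, nsmul_eq_mul]
      push_cast
      ring
    · calc 2 * (2 * κ) = 4 * κ * 1 := by ring
        _ ≤ 4 * κ * r := by gcongr
        _ ≤ L := hL.le
    · calc 4 * m * κ ^ 2 ≤ 16 * m * κ ^ 2 := by gcongr; norm_num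
        _ = Q * (4 * κ * r) ^ 2 := by rw [← hr2]; ring
        _ ≤ Q * L ^ 2 := by gcongr
  have := le_of_forall_gt_of_continuous (f := fun L => (16 * Q * L) ^ Q)
    ((ENNReal.continuous_pow _).comp (ENNReal.continuous_const_mul (by finiteness)))
    ENNReal.coe_ne_top hbound
  refine this.trans (le_of_eq ?_)
  congr 1
  rw [mul_assoc (d * D), ← hQr, hκ]
  push_cast
  ring

/-- Moments of the Euclidean distance of two sample vectors. -/
lemma lintegral_sampleDist_pow_le {s t : T} {d : ℝ≥0} (hX : ∀ t i, Measurable (X t i))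
    (hd : ∀ i, psiNorm 2 (fun x => X s i x - X t i x) (P i) ≤ d) {r : ℕ} (hr : m ≤ r) :
    ∫⁻ ω, ‖sampleDist X s t ω‖ₑ ^ (2 * r) ∂(Measure.pi P)
      ≤ (((NNReal.sqrt 2 * NNReal.sqrt r * d : ℝ≥0) : ℝ≥0∞)) ^ (2 * r) := by
  have hbound : ∀ L : ℝ≥0, (d : ℝ≥0∞) < L →
      ∫⁻ ω, ‖sampleDist X s t ω‖ₑ ^ (2 * r) ∂(Measure.pi P)
        ≤ ((NNReal.sqrt 2 * NNReal.sqrt r : ℝ≥0) * (L : ℝ≥0∞)) ^ (2 * r) := by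
    intro L hL
    have hL' : (0 : ℝ) < L := by exact_mod_cast (zero_le (a := (d : ℝ≥0∞))).trans_lt hL
    have hone : ∀ i, ∫⁻ x, ENNReal.ofReal (Real.exp (((X s i x - X t i x) / L) ^ 2)) ∂(P i) ≤ 2 :=
      fun i => lintegral_exp_sq_le_two ((hd i).trans_lt hL)
    have hm : ∀ i, Measurable fun x => Real.exp (((X s i x - X t i x) / L) ^ 2) := fun i =>
      ((((hX s i).sub (hX t i)).div_const _).pow_const 2).exp
    have hint : ∀ i, Integrable (fun x => Real.exp (((X s i x - X t i x) / L) ^ 2)) (P i) := by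
      refine fun i => ⟨(hm i).aestronglyMeasurable, ?_⟩
      rw [hasFiniteIntegral_iff_ofReal (ae_of_all _ fun x => (Real.exp_pos _).le)]
      exact (hone i).trans_lt (by finiteness)
    have hle : ∀ i, ∫ x, Real.exp (((X s i x - X t i x) / L) ^ 2) ∂(P i) ≤ 2 := fun i => by
      rw [integral_eq_lintegral_of_nonneg_ae (ae_of_all _ fun x => (Real.exp_pos _).le)
        (hm i).aestronglyMeasurable]
      exact ENNReal.toReal_le_of_le_ofReal (by norm_num) (by simpa using hone i)
    -- Independence bounds `E exp (N² / L²)` by `2^m`, which is at most `2^r` because `m ≤ r`. Hence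
    -- no centering is needed at these orders.
    have hexp := lintegral_exp_sum_le hint hle
    have key : ∀ ω : ∀ i, Ω i, ‖sampleDist X s t ω‖ₑ ^ (2 * r)
        ≤ (r.factorial * (L : ℝ≥0∞) ^ (2 * r)) *
          ENNReal.ofReal (Real.exp (∑ i, ((X s i (ω i) - X t i (ω i)) / L) ^ 2)) := by
      intro ω
      have h2 : (r.factorial * (L : ℝ≥0∞) ^ (2 * r))
          = ENNReal.ofReal (r.factorial * L ^ (2 * r)) := by
        rw [ENNReal.ofReal_mul (by positivity), ENNReal.ofReal_pow hL'.le, ENNReal.ofReal_natCast,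
          ENNReal.ofReal_coe_nnreal]
      have h1 : ‖sampleDist X s t ω‖ₑ ^ (2 * r)
          = ENNReal.ofReal ((∑ i, (X s i (ω i) - X t i (ω i)) ^ 2) ^ r) := by
        rw [Real.enorm_eq_ofReal_abs, ← ENNReal.ofReal_pow (abs_nonneg _), pow_mul, sq_abs,
          sampleDist, Real.sq_sqrt (Finset.sum_nonneg fun i _ => sq_nonneg _)]
      rw [h1, h2, ← ENNReal.ofReal_mul (by positivity)]
      refine ENNReal.ofReal_le_ofReal ?_
      have hnn : 0 ≤ ∑ i, ((X s i (ω i) - X t i (ω i)) / L) ^ 2 :=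
        Finset.sum_nonneg fun i _ => sq_nonneg _
      calc (∑ i, (X s i (ω i) - X t i (ω i)) ^ 2) ^ r
          = r.factorial * L ^ (2 * r) *
            ((∑ i, ((X s i (ω i) - X t i (ω i)) / L) ^ 2) ^ r / r.factorial) := by
            simp_rw [div_pow]
            rw [← Finset.sum_div, div_pow, pow_mul]
            field_simp
        _ ≤ _ := by
            gcongr
            exact Real.pow_div_factorial_le_exp _ hnn r
    calc ∫⁻ ω, ‖sampleDist X s t ω‖ₑ ^ (2 * r) ∂(Measure.pi P) ≤ _ := lintegral_mono key
      _ = (r.factorial * (L : ℝ≥0∞) ^ (2 * r)) * ∫⁻ ω, ENNReal.ofReal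
            (Real.exp (∑ i, ((X s i (ω i) - X t i (ω i)) / L) ^ 2)) ∂(Measure.pi P) :=
          lintegral_const_mul' _ _ (by finiteness)
      _ ≤ (r ^ r * (L : ℝ≥0∞) ^ (2 * r)) * 2 ^ r := by
          gcongr
          · exact_mod_cast r.factorial_le_pow
          · refine hexp.trans ?_
            rw [Finset.prod_const, Finset.card_univ, Fintype.card_fin,
              ENNReal.ofReal_pow (by norm_num), ENNReal.ofReal_ofNat]
            exact pow_le_pow_right₀ (by norm_num) hr
      _ = _ := by
          have e : ((NNReal.sqrt 2 * NNReal.sqrt r : ℝ≥0) : ℝ≥0∞) ^ (2 * r) = 2 ^ r * r ^ r := by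
            rw [← ENNReal.coe_pow, pow_mul, mul_pow, NNReal.sq_sqrt, NNReal.sq_sqrt, mul_pow]
            push_cast
            rfl
          rw [mul_pow, e]
          ring
  have := le_of_forall_gt_of_continuous
    (f := fun L => ((NNReal.sqrt 2 * NNReal.sqrt r : ℝ≥0) * L) ^ (2 * r))
    ((ENNReal.continuous_pow _).comp (ENNReal.continuous_const_mul (by finiteness)))
    ENNReal.coe_ne_top hbound
  rwa [ENNReal.coe_mul]

/-- Moments of the quadratic process at one index, under the factorial moment condition. -/
lemma lintegral_centeredSum_pow_le (hm : 1 ≤ m) {t : T} {D : ℝ≥0} (hX : ∀ t i, Measurable (X t i))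
    (ht : ∀ i, psiNorm 2 (X t i) (P i) ≤ D) {σ K : ℝ} (hσ : 0 < σ) (hK : 0 < K)
    (h : MomentCondition P X σ K) {Q : ℕ} (hQ : 1 ≤ Q) :
    ∫⁻ ω, ‖centeredSum P X t ω‖ₑ ^ Q ∂(Measure.pi P)
      ≤ ENNReal.ofReal (16 * (2 * Q * K + √m * √Q * σ)) ^ Q := by
  have hm0 : (0 : ℝ) < m := by exact_mod_cast hm
  have hQ0 : (0 : ℝ) < Q := by exact_mod_cast hQ
  -- The ψ₂ bound serves only for integrability and finite moments; the size of the estimate comes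
  -- from the moment condition.
  have hmom : ∀ i (q : ℕ), 1 ≤ q → ∫⁻ x, ‖X t i x ^ 2 - ∫ x, X t i x ^ 2 ∂(P i)‖ₑ ^ q ∂(P i)
      ≤ q.factorial * (2 * (D : ℝ≥0∞) ^ 2) ^ q := fun i q hq =>
    lintegral_sub_integral_pow_le
      (fun q hq => lintegral_sq_pow_le (hX t i) (ht i) (by finiteness) hq) hq
  have hYm : ∀ i, Measurable fun x => X t i x ^ 2 - ∫ x, X t i x ^ 2 ∂(P i) := fun i =>
    ((hX t i).pow_const 2).sub_const _
  have hsq : ∀ i, Integrable (fun x => X t i x ^ 2) (P i) := fun i =>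
    integrable_sq (hX t i) (ht i) (by finiteness)
  have hpow : ∀ i (q : ℕ), 1 ≤ q →
      ∫⁻ x, ‖X t i x ^ 2 - ∫ x, X t i x ^ 2 ∂(P i)‖ₑ ^ q ∂(P i)
        = ENNReal.ofReal (∫ x, |X t i x ^ 2 - ∫ x, X t i x ^ 2 ∂(P i)| ^ q ∂(P i)) := by
    intro i q hq
    have e : ∀ x, ‖X t i x ^ 2 - ∫ x, X t i x ^ 2 ∂(P i)‖ₑ ^ q
        = ENNReal.ofReal (|X t i x ^ 2 - ∫ x, X t i x ^ 2 ∂(P i)| ^ q) := fun x => by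
      rw [Real.enorm_eq_ofReal_abs, ENNReal.ofReal_pow (abs_nonneg _)]
    have hq' := hmom i q hq
    simp_rw [e] at hq' ⊢
    refine (ofReal_integral_eq_lintegral_ofReal ⟨?_, ?_⟩ (ae_of_all _ fun x => by positivity)).symm
    · exact ((hYm i).norm.pow_const q).aestronglyMeasurable
    · rw [hasFiniteIntegral_iff_ofReal (ae_of_all _ fun x => by positivity)]
      exact hq'.trans_lt (by finiteness)
  -- The sum of the two lower bounds on `L` in the Bernstein estimate, `2K` and `√(v / Q)` with `v =
  -- mσ²`.
  set L : ℝ≥0 := Real.toNNReal (2 * K + √m * σ / √Q) with hL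
  have hLr : (L : ℝ) = 2 * K + √m * σ / √Q := Real.coe_toNNReal _ (by positivity)
  have hsQ : 0 < √(Q : ℝ) := Real.sqrt_pos.2 hQ0
  have hL0 : (0 : ℝ) < L := by rw [hLr]; positivity
  have := lintegral_sum_pow_le (P := P) (v := Real.toNNReal (m * σ ^ 2)) (K := Real.toNNReal K)
    (Y := fun i x => X t i x ^ 2 - ∫ x, X t i x ^ 2 ∂(P i)) hYm
    (fun i => (hsq i).sub (integrable_const _))
    (fun i => by rw [integral_sub (hsq i) (integrable_const _)]; simp) (fun q => ?_) hQ
    (L := L) hL0 ?_ ?_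
  · refine this.trans (le_of_eq ?_)
    congr 1
    rw [← ENNReal.ofReal_coe_nnreal, hLr, ← ENNReal.ofReal_natCast Q,
      ← ENNReal.ofReal_ofNat 16, ← ENNReal.ofReal_mul (by norm_num),
      ← ENNReal.ofReal_mul (by positivity)]
    congr 1
    have := Real.mul_self_sqrt hQ0.le
    have e : √m * σ / √Q * Q = √m * √Q * σ := by
      rw [div_mul_eq_mul_div, div_eq_iff hsQ.ne']
      linear_combination (-(√m * σ)) * this
    linear_combination 16 * e
  · simp_rw [hpow _ (q + 2) (Nat.le_add_left 1 (q + 1))]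
    rw [← ENNReal.ofReal_sum_of_nonneg fun i _ => integral_nonneg fun x => by positivity]
    have h1 := h (q + 2) (Nat.le_add_left 2 q) t
    rw [Nat.add_sub_cancel] at h1
    rw [← ENNReal.ofReal_natCast, ← ENNReal.ofReal_coe_nnreal, ← ENNReal.ofReal_coe_nnreal,
      Real.coe_toNNReal _ (by positivity), Real.coe_toNNReal _ hK.le,
      ← ENNReal.ofReal_pow hK.le, ← ENNReal.ofReal_mul (by positivity),
      ← ENNReal.ofReal_mul (by positivity)]
    refine ENNReal.ofReal_le_ofReal ?_
    rw [one_div, inv_mul_le_iff₀ hm0] at h1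
    refine h1.trans ?_
    have : 0 ≤ ((q + 2).factorial : ℝ) * (m * σ ^ 2 * K ^ q) := by positivity
    linarith
  · rw [← NNReal.coe_le_coe, hLr]
    push_cast
    rw [Real.coe_toNNReal _ hK.le]
    have : 0 ≤ √m * σ / √Q := by positivity
    linarith
  · rw [← NNReal.coe_le_coe]
    push_cast
    rw [Real.coe_toNNReal _ (by positivity), hLr]
    calc (m : ℝ) * σ ^ 2 = Q * (√m * σ / √Q) ^ 2 := by
          rw [div_pow, mul_pow, Real.sq_sqrt hm0.le, Real.sq_sqrt hQ0.le]
          field_simp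
      _ ≤ Q * (2 * K + √m * σ / √Q) ^ 2 := by gcongr; linarith

end QuadraticProcess

/-! ### Maxima over links by union bounds in moments, and approximation chains. -/

lemma rpow_le_one_add_pow (y : ℝ≥0∞) {p : ℝ} (hp : 0 ≤ p) {q : ℕ} (hpq : p ≤ q) :
    y ^ p ≤ 1 + y ^ q := by
  rcases le_total y 1 with h | h
  · exact (ENNReal.rpow_le_one h hp).trans le_self_add
  · rw [← ENNReal.rpow_natCast]
    exact (ENNReal.rpow_le_rpow_of_exponent_le h hpq).trans le_add_self

/-- A finite family of random variables with controlled moments of high order is dominated,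
uniformly, by the moment bounds times one random variable with controlled `p`-th moment. -/
lemma exists_uniform_ratio {Ω ι : Type*} [MeasurableSpace Ω] {μ : Measure Ω}
    [IsProbabilityMeasure μ] (J : Finset ι) {Z : ι → Ω → ℝ≥0∞} (hZ : ∀ j, Measurable (Z j))
    {w : ι → ℝ≥0∞} (hw : ∀ j ∈ J, w j ≠ ∞) {q : ι → ℕ} {p : ℝ} (hp : 0 < p)
    (hpq : ∀ j ∈ J, p ≤ q j) (hmom : ∀ j ∈ J, ∫⁻ ω, Z j ω ^ q j ∂μ ≤ w j ^ q j)
    {v : ℝ≥0} (hv : v ≠ 0) (hsum : ∑ j ∈ J, (v : ℝ≥0∞)⁻¹ ^ q j ≤ 1) :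
    ∃ ξ : Ω → ℝ≥0∞, Measurable ξ ∧ ∫⁻ ω, ξ ω ^ p ∂μ ≤ 2 ∧
      ∀ᵐ ω ∂μ, ∀ j ∈ J, Z j ω ≤ v * ξ ω * w j := by
  have hv' : (v : ℝ≥0∞) ≠ 0 := by exact_mod_cast hv
  have hq : ∀ j ∈ J, q j ≠ 0 := fun j hj h0 => by
    have := hpq j hj
    rw [h0, Nat.cast_zero] at this
    linarith
  -- The largest normalised ratio. Its `p`-th power is at most `1` plus the sum of the ratios raised
  -- to their own orders `q j`, a union bound adapted to each index.
  refine ⟨fun ω => J.sup fun j => Z j ω * (v * w j)⁻¹, ?_, ?_, ?_⟩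
  · simp_rw [Finset.sup_eq_iSup]
    exact .biSup _ J.countable_toSet fun j _ => (hZ j).mul_const _
  · have hpt : ∀ ω, (J.sup fun j => Z j ω * (v * w j)⁻¹) ^ p
        ≤ 1 + ∑ j ∈ J, (Z j ω * (v * w j)⁻¹) ^ q j := by
      intro ω
      rcases J.eq_empty_or_nonempty with rfl | hne
      · simp [ENNReal.zero_rpow_of_pos hp]
      obtain ⟨j, hj, he⟩ := Finset.exists_mem_eq_sup J hne fun j => Z j ω * (v * w j)⁻¹
      rw [he]
      exact (rpow_le_one_add_pow _ hp.le (hpq j hj)).trans (add_le_add le_rfl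
        (Finset.single_le_sum (f := fun j => (Z j ω * (v * w j)⁻¹) ^ q j)
          (fun _ _ => zero_le) hj))
    calc ∫⁻ ω, (J.sup fun j => Z j ω * (v * w j)⁻¹) ^ p ∂μ
        ≤ ∫⁻ ω, (1 + ∑ j ∈ J, (Z j ω * (v * w j)⁻¹) ^ q j) ∂μ := lintegral_mono hpt
      _ = 1 + ∑ j ∈ J, ∫⁻ ω, (Z j ω * (v * w j)⁻¹) ^ q j ∂μ := by
          rw [lintegral_add_left measurable_const, lintegral_finsetSum _
            fun j _ => ((hZ j).mul_const _).pow_const _]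
          simp
      _ ≤ 1 + ∑ j ∈ J, (v : ℝ≥0∞)⁻¹ ^ q j := by
          gcongr with j hj
          simp_rw [mul_pow]
          rw [lintegral_mul_const _ ((hZ j).pow_const _)]
          calc (∫⁻ ω, Z j ω ^ q j ∂μ) * (v * w j)⁻¹ ^ q j
              ≤ w j ^ q j * (v * w j)⁻¹ ^ q j := by gcongr; exact hmom j hj
            _ = ((v : ℝ≥0∞)⁻¹ * (w j * (w j)⁻¹)) ^ q j := by
                rw [ENNReal.mul_inv (Or.inl hv') (Or.inl ENNReal.coe_ne_top), ← mul_pow]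
                ring
            _ ≤ ((v : ℝ≥0∞)⁻¹ * 1) ^ q j := by
                gcongr
                exact ENNReal.mul_inv_le_one _
            _ = _ := by rw [mul_one]
      _ ≤ 1 + 1 := by gcongr
      _ = 2 := one_add_one_eq_two
  · rw [Finset.eventually_all]
    intro j hj
    -- A zero bound cannot be inverted, but it forces `Z j = 0` almost everywhere.
    rcases eq_or_ne (w j) 0 with h0 | h0
    · have h1 := hmom j hj
      rw [h0, zero_pow (hq j hj), nonpos_iff_eq_zero,
        lintegral_eq_zero_iff ((hZ j).pow_const _)] at h1
      filter_upwards [h1] with ω hω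
      have : Z j ω = 0 := eq_zero_of_pow_eq_zero hω
      rw [this]
      exact zero_le
    · refine ae_of_all _ fun ω => ?_
      have h1 : Z j ω * (v * w j)⁻¹ ≤ J.sup fun j => Z j ω * (v * w j)⁻¹ :=
        Finset.le_sup (f := fun j => Z j ω * (v * w j)⁻¹) hj
      calc Z j ω = Z j ω * (v * w j)⁻¹ * (v * w j) := by
            rw [mul_assoc, ENNReal.inv_mul_cancel (mul_ne_zero hv' h0)
              (ENNReal.mul_ne_top ENNReal.coe_ne_top (hw j hj)), mul_one]
        _ ≤ (J.sup fun j => Z j ω * (v * w j)⁻¹) * (v * w j) := by gcongr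
        _ = _ := by ring

/-- There are at most `4^(2^(n+1))` links at level `n`. Of `16 = 4 * 4`, one factor pays for
counting them; the other leaves at most `2^(-(n+1))`, which sums to `1`. -/
lemma sum_card_chain_le {T : Type*} [Fintype T] [DecidableEq T] {π : ℕ → T → T}
    (hπ : ∀ n, (Finset.univ.image (π n)).card ≤ 2 ^ 2 ^ n) (I : Finset ℕ) {q : ℕ → ℕ}
    (hq : ∀ n ∈ I, 2 ^ (n + 1) ≤ q n) :
    ∑ j ∈ I.sigma fun n => Finset.univ.image (π (n + 1)) ×ˢ Finset.univ.image (π n),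
      (((16 : ℝ≥0) : ℝ≥0∞))⁻¹ ^ q j.1 ≤ 1 := by
  rw [Finset.sum_sigma]
  simp only [Finset.sum_const, Finset.card_product, nsmul_eq_mul]
  calc ∑ n ∈ I, (((Finset.univ.image (π (n + 1))).card * (Finset.univ.image (π n)).card : ℕ) : ℝ≥0∞)
        * (((16 : ℝ≥0) : ℝ≥0∞))⁻¹ ^ q n
      ≤ ∑ n ∈ I, (2⁻¹ : ℝ≥0∞) ^ (n + 1) := by
        refine Finset.sum_le_sum fun n hn => ?_
        have hc : (Finset.univ.image (π (n + 1))).card * (Finset.univ.image (π n)).card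
            ≤ 4 ^ 2 ^ (n + 1) := by
          calc _ ≤ 2 ^ 2 ^ (n + 1) * 2 ^ 2 ^ n := Nat.mul_le_mul (hπ _) (hπ _)
            _ ≤ 2 ^ 2 ^ (n + 1) * 2 ^ 2 ^ (n + 1) := by gcongr <;> omega
            _ = 4 ^ 2 ^ (n + 1) := by rw [← mul_pow]; norm_num
        have h16 : (((16 : ℝ≥0) : ℝ≥0∞))⁻¹ = 4⁻¹ * 4⁻¹ := by
          rw [← ENNReal.mul_inv (by simp) (by simp)]; norm_num
        calc _ ≤ ((4 ^ 2 ^ (n + 1) : ℕ) : ℝ≥0∞) * (((16 : ℝ≥0) : ℝ≥0∞))⁻¹ ^ 2 ^ (n + 1) := by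
              gcongr ?_ * ?_
              · exact_mod_cast hc
              · exact pow_le_pow_right_of_le_one' (by simp) (hq n hn)
          _ = (4⁻¹ : ℝ≥0∞) ^ 2 ^ (n + 1) := by
              rw [h16, mul_pow, ← mul_assoc]
              push_cast
              rw [← mul_pow, ENNReal.mul_inv_cancel (by simp) (by simp), one_pow, one_mul]
          _ ≤ (2⁻¹ : ℝ≥0∞) ^ 2 ^ (n + 1) := by gcongr; norm_num
          _ ≤ (2⁻¹ : ℝ≥0∞) ^ (n + 1) :=
              pow_le_pow_right_of_le_one' (by simp) (Nat.lt_two_pow_self).le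
    _ ≤ ∑' n : ℕ, (2⁻¹ : ℝ≥0∞) ^ (n + 1) := ENNReal.sum_le_tsum _
    _ = 1 := by
        rw [ENNReal.tsum_geometric_add_one, ENNReal.one_sub_inv_two, inv_inv]
        exact ENNReal.inv_mul_cancel (by simp) (by simp)

/-- The union bound over all pairs of a level and a link. A single `ξ` serves every level and every
`t`, so what remains for fixed `ω` is a deterministic sum. -/
lemma exists_chain_ratio {Ω T : Type*} [MeasurableSpace Ω] {μ : Measure Ω}
    [IsProbabilityMeasure μ] [Fintype T] [DecidableEq T] {π : ℕ → T → T}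
    (hπ : ∀ n, (Finset.univ.image (π n)).card ≤ 2 ^ 2 ^ n) (I : Finset ℕ)
    {Z : T → T → Ω → ℝ≥0∞} (hZ : ∀ s t, Measurable (Z s t))
    {w : ℕ → T → T → ℝ≥0∞} (hw : ∀ n s t, w n s t ≠ ∞) {q : ℕ → ℕ} {p : ℝ} (hp : 0 < p)
    (hpq : ∀ n ∈ I, p ≤ q n) (hq : ∀ n ∈ I, 2 ^ (n + 1) ≤ q n)
    (hmom : ∀ n ∈ I, ∀ s t, ∫⁻ ω, Z s t ω ^ q n ∂μ ≤ w n s t ^ q n) :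
    ∃ ξ : Ω → ℝ≥0∞, Measurable ξ ∧ ∫⁻ ω, ξ ω ^ p ∂μ ≤ 2 ∧
      ∀ᵐ ω ∂μ, ∀ n ∈ I, ∀ t, Z (π (n + 1) t) (π n t) ω
        ≤ 16 * ξ ω * w n (π (n + 1) t) (π n t) := by
  obtain ⟨ξ, hξm, hξ, h⟩ := exists_uniform_ratio (μ := μ)
    (I.sigma fun n => Finset.univ.image (π (n + 1)) ×ˢ Finset.univ.image (π n))
    (Z := fun j : Σ _ : ℕ, T × T => Z j.2.1 j.2.2) (fun j => hZ _ _)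
    (w := fun j => w j.1 j.2.1 j.2.2) (fun j _ => hw _ _ _) (q := fun j => q j.1) hp
    (fun j hj => hpq _ (Finset.mem_sigma.1 hj).1)
    (fun j hj => hmom _ (Finset.mem_sigma.1 hj).1 _ _)
    (v := 16) (by norm_num) (sum_card_chain_le hπ I hq)
  refine ⟨ξ, hξm, hξ, ?_⟩
  filter_upwards [h] with ω hω n hn t
  exact hω ⟨n, (π (n + 1) t, π n t)⟩ (by simp [hn])

/-- The admissible sequences yield chains of approximations which are eventually the identity. -/
lemma exists_chain {T : Type*} [Fintype T] [DecidableEq T] [Nonempty T] {d : T → T → ℝ≥0∞}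
    (hd : ∀ t, d t t = 0) {S : ℕ → Finset T} (hS : IsAdmissible S) :
    ∃ π : ℕ → T → T, (∀ n, (Finset.univ.image (π n)).card ≤ 2 ^ 2 ^ n) ∧
      (∃ N, ∀ n, N ≤ n → ∀ t, π n t = t) ∧ ∀ n t, d t (π n t) ≤ distTo d t (S n) := by
  have hex : ∀ n, ∃ f : T → T, (Finset.univ.image f).card ≤ 2 ^ 2 ^ n ∧
      (Fintype.card T ≤ 2 ^ 2 ^ n → ∀ t, f t = t) ∧ ∀ t, d t (f t) ≤ distTo d t (S n) := by
    intro n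
    -- Once all of `T` fits into the cardinality bound the identity is used, so that chains reach
    -- `t` after finitely many steps.
    by_cases hn : Fintype.card T ≤ 2 ^ 2 ^ n
    · exact ⟨id, (Finset.card_le_univ _).trans hn, fun _ _ => rfl, fun t => by simp [hd]⟩
    -- Admissibility allows `S n` to be empty for `n ≥ 1`; then `distTo` is infinite and any
    -- constant map will do.
    rcases (S n).eq_empty_or_nonempty with he | hne
    · refine ⟨fun _ => Classical.arbitrary T, ?_, fun h => absurd h hn, fun t => ?_⟩
      · rw [Finset.image_const Finset.univ_nonempty, Finset.card_singleton]
        exact Nat.one_le_two_pow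
      · simp [distTo, he]
    · choose f hf hmin using fun t => Finset.exists_min_image (S n) (d t) hne
      refine ⟨f, ?_, fun h => absurd h hn, fun t => le_iInf₂ fun s hs => hmin t s hs⟩
      refine (Finset.card_le_card (Finset.image_subset_iff.2 fun t _ => hf t)).trans ?_
      rcases Nat.eq_zero_or_pos n with rfl | hn0
      · rw [hS.1]; norm_num
      · exact hS.2 n hn0
  choose π h1 h2 h3 using hex
  refine ⟨π, h1, ⟨Fintype.card T, fun n hn => h2 n (hn.trans ?_)⟩, h3⟩
  exact Nat.lt_two_pow_self.le.trans Nat.lt_two_pow_self.le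

lemma sqrt_two_pow_eq (n : ℕ) :
    ((NNReal.sqrt (2 ^ n) : ℝ≥0) : ℝ≥0∞) = (2 : ℝ≥0∞) ^ ((n : ℝ) / 2) := by
  rw [NNReal.sqrt_eq_rpow, ENNReal.coe_rpow_of_nonneg _ (by norm_num), ENNReal.coe_pow,
    ENNReal.coe_ofNat, ← ENNReal.rpow_natCast, ← ENNReal.rpow_mul]
  congr 1
  ring

lemma two_rpow_succ_le (n : ℕ) :
    (2 : ℝ≥0∞) ^ (((n + 1 : ℕ) : ℝ) / 2) ≤ 2 * (2 : ℝ≥0∞) ^ ((n : ℝ) / 2) := by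
  calc (2 : ℝ≥0∞) ^ (((n + 1 : ℕ) : ℝ) / 2) ≤ (2 : ℝ≥0∞) ^ (1 + (n : ℝ) / 2) := by
        refine ENNReal.rpow_le_rpow_of_exponent_le (by norm_num) ?_
        push_cast
        linarith
    _ = _ := by rw [ENNReal.rpow_add _ _ (by simp) (by simp), ENNReal.rpow_one]

lemma sum_le_tsum_Ici {f : ℕ → ℝ≥0∞} {ℓ : ℕ} {I : Finset ℕ} (hI : ∀ n ∈ I, ℓ ≤ n) :
    ∑ n ∈ I, f n ≤ ∑' n : Set.Ici ℓ, f n := by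
  rw [tsum_subtype (Set.Ici ℓ) f]
  refine le_trans (le_of_eq (Finset.sum_congr rfl fun n hn => ?_)) (ENNReal.sum_le_tsum I)
  exact (Set.indicator_of_mem (show n ∈ Set.Ici ℓ from hI n hn) f).symm

/-- The weighted length of a chain is controlled by the weighted approximation errors. -/
lemma sum_chain_le {T : Type*} {d : T → T → ℝ≥0∞}
    (htri : ∀ s t u, d s u ≤ d t s + d t u) {π : ℕ → T → T} {t : T} {G : ℝ≥0∞} {ℓ : ℕ}
    (hG : ∑' n : Set.Ici ℓ, (2 : ℝ≥0∞) ^ (((n : ℕ) : ℝ) / 2) * d t (π n t) ≤ G)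
    {k M : ℕ} (hk : ℓ ≤ k) :
    ∑ n ∈ Finset.Ico k M, (2 : ℝ≥0∞) ^ (((n + 1 : ℕ) : ℝ) / 2) * d (π (n + 1) t) (π n t)
      ≤ 3 * G := by
  set f : ℕ → ℝ≥0∞ := fun n => (2 : ℝ≥0∞) ^ ((n : ℝ) / 2) * d t (π n t) with hf
  calc ∑ n ∈ Finset.Ico k M, (2 : ℝ≥0∞) ^ (((n + 1 : ℕ) : ℝ) / 2) * d (π (n + 1) t) (π n t)
      ≤ ∑ n ∈ Finset.Ico k M, (f (n + 1) + 2 * f n) := by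
        refine Finset.sum_le_sum fun n _ => ?_
        calc _ ≤ (2 : ℝ≥0∞) ^ (((n + 1 : ℕ) : ℝ) / 2)
              * (d t (π (n + 1) t) + d t (π n t)) := by gcongr; exact htri _ _ _
          _ ≤ f (n + 1) + (2 * (2 : ℝ≥0∞) ^ ((n : ℝ) / 2)) * d t (π n t) := by
              rw [mul_add]
              gcongr
              exact two_rpow_succ_le n
          _ = _ := by rw [mul_assoc]
    _ = ∑ n ∈ Finset.Ico (k + 1) (M + 1), f n + 2 * ∑ n ∈ Finset.Ico k M, f n := by
        rw [Finset.sum_add_distrib, ← Finset.mul_sum, ← Finset.sum_Ico_add' f k M 1]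
    _ ≤ G + 2 * G := by
        gcongr
        · exact (sum_le_tsum_Ici fun n hn => by rw [Finset.mem_Ico] at hn; omega).trans hG
        · exact (sum_le_tsum_Ici fun n hn => by rw [Finset.mem_Ico] at hn; omega).trans hG
    _ = 3 * G := by ring

/-! ### Minkowski's inequality in the form used for the final combination. -/

section Norms

variable {Ω : Type*} [MeasurableSpace Ω] {μ : Measure Ω}

lemma lintegral_rpow_mul_const_le {f : Ω → ℝ≥0∞} (hf : Measurable f) {p : ℝ} (hp : 1 ≤ p)
    (h : ∫⁻ ω, f ω ^ p ∂μ ≤ 2) (c : ℝ≥0∞) :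
    (∫⁻ ω, (f ω * c) ^ p ∂μ) ^ (1 / p) ≤ 2 * c := by
  have hp0 : 0 < p := by linarith
  simp_rw [ENNReal.mul_rpow_of_nonneg _ _ hp0.le]
  rw [lintegral_mul_const _ (hf.pow_const p), ENNReal.mul_rpow_of_nonneg _ _ (by positivity),
    ← ENNReal.rpow_mul, mul_one_div_cancel hp0.ne', ENNReal.rpow_one]
  gcongr
  calc (∫⁻ ω, f ω ^ p ∂μ) ^ (1 / p) ≤ 2 ^ (1 / p) := by gcongr
    _ ≤ 2 ^ (1 : ℝ) := ENNReal.rpow_le_rpow_of_exponent_le (by norm_num)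
        (by rw [div_le_one hp0]; exact hp)
    _ = 2 := ENNReal.rpow_one 2

lemma lintegral_rpow_combination_le [IsProbabilityMeasure μ] {f g h : Ω → ℝ≥0∞}
    (hf : Measurable f) (hg : Measurable g) (hh : Measurable h) {p : ℝ} (hp : 1 ≤ p)
    (hf2 : ∫⁻ ω, f ω ^ p ∂μ ≤ 2) (hg2 : ∫⁻ ω, g ω ^ p ∂μ ≤ 2) (hh2 : ∫⁻ ω, h ω ^ p ∂μ ≤ 2)
    (a b c e : ℝ≥0∞) :
    (∫⁻ ω, (f ω * a + (g ω * b + (h ω * c + e))) ^ p ∂μ) ^ (1 / p)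
      ≤ 2 * a + (2 * b + (2 * c + e)) := by
  have hp0 : 0 < p := by linarith
  have he : (∫⁻ _, e ^ p ∂μ) ^ (1 / p) = e := by
    rw [lintegral_const, measure_univ, mul_one, ← ENNReal.rpow_mul, mul_one_div_cancel hp0.ne',
      ENNReal.rpow_one]
  have h1 := ENNReal.lintegral_Lp_add_le (μ := μ) (f := fun ω => f ω * a)
    (g := fun ω => g ω * b + (h ω * c + e)) (by fun_prop) (by fun_prop) hp
  have h2 := ENNReal.lintegral_Lp_add_le (μ := μ) (f := fun ω => g ω * b)
    (g := fun ω => h ω * c + e) (by fun_prop) (by fun_prop) hp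
  have h3 := ENNReal.lintegral_Lp_add_le (μ := μ) (f := fun ω => h ω * c)
    (g := fun _ => e) (by fun_prop) (by fun_prop) hp
  simp only [Pi.add_apply, he] at h1 h2 h3
  have := lintegral_rpow_mul_const_le hf hp hf2 a
  have := lintegral_rpow_mul_const_le hg hp hg2 b
  have := lintegral_rpow_mul_const_le hh hp hh2 c
  exact h1.trans (add_le_add ‹_› (h2.trans (add_le_add ‹_› (h3.trans (add_le_add ‹_› le_rfl)))))

end Norms

/-! ### Chaining on the three ranges of levels. -/

section Chaining

variable {m : ℕ} {Ω : Fin m → Type*} {T : Type*} [∀ i, MeasurableSpace (Ω i)]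
  {P : ∀ i, Measure (Ω i)} {X : T → ∀ i, Ω i → ℝ} {D : ℝ≥0}

lemma psiNorm_sub_le_dPsi2 (s t : T) (i : Fin m) :
    psiNorm 2 (fun x => X s i x - X t i x) (P i) ≤ dPsi2 P X s t :=
  le_iSup (fun i => psiNorm 2 (fun x => X s i x - X t i x) (P i)) i

lemma dPsi2_self (t : T) : dPsi2 P X t t = 0 := by
  simp [dPsi2, psiNorm_zero]

lemma dPsi2_triangle (hX : ∀ t i, Measurable (X t i)) (s t u : T) :
    dPsi2 P X s u ≤ dPsi2 P X t s + dPsi2 P X t u := by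
  refine iSup_le fun i => ?_
  calc psiNorm 2 (fun x => X s i x - X u i x) (P i)
      = psiNorm 2 (fun x => (X s i x - X t i x) + (X t i x - X u i x)) (P i) := by
        simp only [sub_add_sub_cancel]
    _ ≤ psiNorm 2 (fun x => X s i x - X t i x) (P i)
        + psiNorm 2 (fun x => X t i x - X u i x) (P i) := psiNorm_add_le ((hX s i).sub (hX t i))
    _ = psiNorm 2 (fun x => X t i x - X s i x) (P i)
        + psiNorm 2 (fun x => X t i x - X u i x) (P i) := by rw [psiNorm_sub_comm (X := X s i)]
    _ ≤ _ := add_le_add (psiNorm_sub_le_dPsi2 t s i) (psiNorm_sub_le_dPsi2 t u i)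

lemma dPsi2_ne_top (hX : ∀ t i, Measurable (X t i)) (hD : ∀ t i, psiNorm 2 (X t i) (P i) ≤ D)
    (s t : T) : dPsi2 P X s t ≠ ∞ := by
  refine ne_top_of_le_ne_top (b := (D : ℝ≥0∞) + D) (by finiteness) (iSup_le fun i => ?_)
  have h := psiNorm_add_le (P := P i) (X := X s i) (Y := fun x => -X t i x) (hX s i)
  rw [psiNorm_neg] at h
  simp only [← sub_eq_add_neg] at h
  exact h.trans (add_le_add (hD s i) (hD t i))

lemma enorm_centeredSum_le (hX : ∀ t i, Measurable (X t i))
    (hD : ∀ t i, psiNorm 2 (X t i) (P i) ≤ D) (s t : T) (ω : ∀ i, Ω i) :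
    ‖centeredSum P X s ω‖ₑ ≤ 2 * ‖centeredSum P X t ω‖ₑ + 2 * ‖sampleDist X s t ω‖ₑ ^ 2
      + 2 * (NNReal.sqrt m : ℝ≥0) * D * ‖sampleDist X s t ω‖ₑ + 2 * m * dPsi2 P X s t * D := by
  obtain ⟨d, hd⟩ : ∃ d : ℝ≥0, (d : ℝ≥0∞) = dPsi2 P X s t :=
    ⟨_, ENNReal.coe_toNNReal (dPsi2_ne_top hX hD s t)⟩
  have h := abs_centeredSum_le hX (fun i => hd ▸ psiNorm_sub_le_dPsi2 s t i) (hD s) (hD t) ω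
  have h2 : ‖centeredSum P X s ω‖₊ ≤ 2 * ‖centeredSum P X t ω‖₊ + 2 * ‖sampleDist X s t ω‖₊ ^ 2
      + 2 * NNReal.sqrt m * D * ‖sampleDist X s t ω‖₊ + 2 * m * d * D := by
    rw [← NNReal.coe_le_coe]
    push_cast
    rw [Real.norm_eq_abs, Real.norm_eq_abs, Real.norm_of_nonneg (sampleDist_nonneg X s t ω)]
    exact h
  rw [← hd]
  simp only [enorm_eq_nnnorm]
  exact_mod_cast h2

variable [∀ i, IsProbabilityMeasure (P i)]

/-- At order `Q = 2^n` the factor `√Q` becomes exactly the weight `2^(n/2)` of the `γ₂` functional.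
-/
lemma lintegral_increment_pow_le (hX : ∀ t i, Measurable (X t i))
    (hD : ∀ t i, psiNorm 2 (X t i) (P i) ≤ D) (s t : T) {n : ℕ} (hn : 2 ^ n ≤ m) :
    ∫⁻ ω, ‖centeredSum P X s ω - centeredSum P X t ω‖ₑ ^ 2 ^ n ∂(Measure.pi P)
      ≤ (128 * ((NNReal.sqrt m : ℝ≥0) * D * ((2 : ℝ≥0∞) ^ ((n : ℝ) / 2) * dPsi2 P X s t)))
        ^ 2 ^ n := by
  obtain ⟨d, hd⟩ : ∃ d : ℝ≥0, (d : ℝ≥0∞) = dPsi2 P X s t :=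
    ⟨_, ENNReal.coe_toNNReal (dPsi2_ne_top hX hD s t)⟩
  refine (lintegral_centeredSum_sub_pow_le hX (fun i => hd ▸ psiNorm_sub_le_dPsi2 s t i) (hD s)
    (hD t) Nat.one_le_two_pow hn).trans (le_of_eq ?_)
  rw [← hd, ← sqrt_two_pow_eq]
  push_cast
  ring

lemma lintegral_sampleDist_two_pow_le (hX : ∀ t i, Measurable (X t i))
    (hD : ∀ t i, psiNorm 2 (X t i) (P i) ≤ D) (s t : T) {n : ℕ} (hn : m ≤ 2 ^ n) :
    ∫⁻ ω, ‖sampleDist X s t ω‖ₑ ^ (2 * 2 ^ n) ∂(Measure.pi P)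
      ≤ (2 * ((2 : ℝ≥0∞) ^ ((n : ℝ) / 2) * dPsi2 P X s t)) ^ (2 * 2 ^ n) := by
  obtain ⟨d, hd⟩ : ∃ d : ℝ≥0, (d : ℝ≥0∞) = dPsi2 P X s t :=
    ⟨_, ENNReal.coe_toNNReal (dPsi2_ne_top hX hD s t)⟩
  refine (lintegral_sampleDist_pow_le hX (fun i => hd ▸ psiNorm_sub_le_dPsi2 s t i) hn).trans ?_
  gcongr
  rw [← hd, ← sqrt_two_pow_eq]
  have : NNReal.sqrt 2 ≤ 2 := by
    rw [NNReal.sqrt_le_iff_le_sq]; norm_num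
  push_cast
  rw [mul_assoc]
  gcongr
  exact_mod_cast this

variable [Fintype T] [DecidableEq T] {π : ℕ → T → T} {G : ℝ≥0∞} {ℓ : ℕ}

/-- The contribution of the levels at which Bernstein's inequality is subgaussian. -/
lemma exists_bound_low_levels (hX : ∀ t i, Measurable (X t i))
    (hD : ∀ t i, psiNorm 2 (X t i) (P i) ≤ D)
    (hπ : ∀ n, (Finset.univ.image (π n)).card ≤ 2 ^ 2 ^ n)
    (hG : ∀ t, ∑' n : Set.Ici ℓ, (2 : ℝ≥0∞) ^ (((n : ℕ) : ℝ) / 2) * dPsi2 P X t (π n t) ≤ G)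
    {p : ℝ} (hp : 1 ≤ p) (hpℓ : p ≤ 2 ^ (ℓ + 1)) {k : ℕ} (hℓk : ℓ ≤ k)
    (hk : ∀ n, ℓ ≤ n → n < k → 2 ^ (n + 1) ≤ m) :
    ∃ ξ : (∀ i, Ω i) → ℝ≥0∞, Measurable ξ ∧ ∫⁻ ω, ξ ω ^ p ∂(Measure.pi P) ≤ 2 ∧
      ∀ᵐ ω ∂(Measure.pi P), ∀ t, ‖centeredSum P X (π k t) ω‖ₑ
        ≤ ‖centeredSum P X (π ℓ t) ω‖ₑ + 6144 * (ξ ω * ((NNReal.sqrt m : ℝ≥0) * D * G)) := by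
  -- The link from level `n` to `n + 1` is measured at order `2^(n+1)`, which is at least `p` from
  -- level `ℓ` on; hence the truncated sum suffices.
  obtain ⟨ξ, hξm, hξ, h⟩ := exists_chain_ratio (μ := Measure.pi P) hπ (Finset.Ico ℓ k)
    (Z := fun s t ω => ‖centeredSum P X s ω - centeredSum P X t ω‖ₑ)
    (fun s t => ((measurable_centeredSum hX s).sub (measurable_centeredSum hX t)).enorm)
    (w := fun n s t => 128 * ((NNReal.sqrt m : ℝ≥0) * D *
      ((2 : ℝ≥0∞) ^ (((n + 1 : ℕ) : ℝ) / 2) * dPsi2 P X s t)))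
    (fun n s t => by have := dPsi2_ne_top hX hD s t; finiteness) (q := fun n => 2 ^ (n + 1))
    (p := p) (by linarith)
    (fun n hn => hpℓ.trans (by
      push_cast
      exact pow_le_pow_right₀ one_le_two (by rw [Finset.mem_Ico] at hn; omega)))
    (fun n _ => le_rfl)
    (fun n hn s t => lintegral_increment_pow_le hX hD s t (by
      rw [Finset.mem_Ico] at hn; exact hk n hn.1 hn.2))
  refine ⟨ξ, hξm, hξ, ?_⟩
  filter_upwards [h] with ω hω t
  have htel := edist_le_Ico_sum_edist (fun n => centeredSum P X (π n t) ω) hℓk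
  have h1 : ‖centeredSum P X (π k t) ω‖ₑ ≤ ‖centeredSum P X (π ℓ t) ω‖ₑ
      + edist (centeredSum P X (π ℓ t) ω) (centeredSum P X (π k t) ω) := by
    rw [edist_comm, edist_eq_enorm_sub]
    calc _ = ‖centeredSum P X (π ℓ t) ω + (centeredSum P X (π k t) ω
          - centeredSum P X (π ℓ t) ω)‖ₑ := by rw [add_sub_cancel]
      _ ≤ _ := enorm_add_le _ _
  refine h1.trans (add_le_add le_rfl (htel.trans ?_))
  -- `2048 = 16 * 128` combines the union bound with the Bernstein constant; `sum_chain_le`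
  -- contributes the factor `3`.
  calc ∑ n ∈ Finset.Ico ℓ k, edist (centeredSum P X (π n t) ω) (centeredSum P X (π (n + 1) t) ω)
      ≤ ∑ n ∈ Finset.Ico ℓ k, 2048 * ξ ω * ((NNReal.sqrt m : ℝ≥0) * D) *
        ((2 : ℝ≥0∞) ^ (((n + 1 : ℕ) : ℝ) / 2) * dPsi2 P X (π (n + 1) t) (π n t)) := by
        refine Finset.sum_le_sum fun n hn => ?_
        rw [edist_comm, edist_eq_enorm_sub]
        refine (hω n hn t).trans (le_of_eq ?_)
        ring
    _ ≤ 2048 * ξ ω * ((NNReal.sqrt m : ℝ≥0) * D) * (3 * G) := by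
        rw [← Finset.mul_sum]
        gcongr
        exact sum_chain_le (dPsi2_triangle hX) (hG t) le_rfl
    _ = _ := by ring

/-- The contribution of the levels beyond the sample size, through the Euclidean distance of the
sample vectors. -/
lemma exists_bound_high_levels (hX : ∀ t i, Measurable (X t i))
    (hD : ∀ t i, psiNorm 2 (X t i) (P i) ≤ D)
    (hπ : ∀ n, (Finset.univ.image (π n)).card ≤ 2 ^ 2 ^ n)
    (hfin : ∃ N, ∀ n, N ≤ n → ∀ t, π n t = t)
    (hG : ∀ t, ∑' n : Set.Ici ℓ, (2 : ℝ≥0∞) ^ (((n : ℕ) : ℝ) / 2) * dPsi2 P X t (π n t) ≤ G)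
    {p : ℝ} (hp : 1 ≤ p) (hpℓ : p ≤ 2 ^ (ℓ + 1)) {k : ℕ} (hℓk : ℓ ≤ k) (hk : m ≤ 2 ^ (k + 1)) :
    ∃ ζ : (∀ i, Ω i) → ℝ≥0∞, Measurable ζ ∧ ∫⁻ ω, (ζ ω ^ 2) ^ p ∂(Measure.pi P) ≤ 2 ∧
      ∀ᵐ ω ∂(Measure.pi P), ∀ t, ‖sampleDist X t (π k t) ω‖ₑ ≤ 96 * (ζ ω * G) := by
  obtain ⟨N, hN⟩ := hfin
  -- Order `2 * p` is requested because the squared distance enters the final bound. The upper level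
  -- `max k N` makes the chain end at `t`.
  obtain ⟨ζ, hζm, hζ, h⟩ := exists_chain_ratio (μ := Measure.pi P) hπ (Finset.Ico k (max k N))
    (Z := fun s t ω => ‖sampleDist X s t ω‖ₑ) (fun s t => (measurable_sampleDist hX s t).enorm)
    (w := fun n s t => 2 * ((2 : ℝ≥0∞) ^ (((n + 1 : ℕ) : ℝ) / 2) * dPsi2 P X s t))
    (fun n s t => by have := dPsi2_ne_top hX hD s t; finiteness) (q := fun n => 2 * 2 ^ (n + 1))
    (p := 2 * p) (by linarith)
    (fun n hn => by
      push_cast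
      refine mul_le_mul_of_nonneg_left (hpℓ.trans ?_) (by norm_num)
      exact pow_le_pow_right₀ one_le_two (by rw [Finset.mem_Ico] at hn; omega))
    (fun n _ => by omega)
    (fun n hn s t => lintegral_sampleDist_two_pow_le hX hD s t (hk.trans (by
      exact pow_le_pow_right₀ one_le_two (by rw [Finset.mem_Ico] at hn; omega))))
  refine ⟨ζ, hζm, ?_, ?_⟩
  · simp_rw [← ENNReal.rpow_two, ← ENNReal.rpow_mul]
    exact hζ
  filter_upwards [h] with ω hω t
  have htel := edist_le_Ico_sum_edist
    (fun n => (WithLp.toLp 2 fun i => X (π n t) i (ω i) : EuclideanSpace ℝ (Fin m)))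
    (le_max_left k N)
  have e : ∀ s t, ‖sampleDist X s t ω‖ₑ
      = edist (WithLp.toLp 2 fun i => X s i (ω i) : EuclideanSpace ℝ (Fin m))
        (WithLp.toLp 2 fun i => X t i (ω i)) := fun s t => by
    rw [sampleDist_eq_dist, edist_dist, Real.enorm_eq_ofReal_abs, abs_of_nonneg dist_nonneg]
  rw [hN _ (le_max_right k N), edist_comm, ← e] at htel
  refine htel.trans ?_
  calc ∑ n ∈ Finset.Ico k (max k N), edist
        (WithLp.toLp 2 fun i => X (π n t) i (ω i) : EuclideanSpace ℝ (Fin m))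
        (WithLp.toLp 2 fun i => X (π (n + 1) t) i (ω i))
      ≤ ∑ n ∈ Finset.Ico k (max k N), 32 * ζ ω *
        ((2 : ℝ≥0∞) ^ (((n + 1 : ℕ) : ℝ) / 2) * dPsi2 P X (π (n + 1) t) (π n t)) := by
        refine Finset.sum_le_sum fun n hn => ?_
        rw [edist_comm, ← e]
        refine (hω n hn t).trans (le_of_eq ?_)
        ring
    _ ≤ 32 * ζ ω * (3 * G) := by
        rw [← Finset.mul_sum]
        gcongr
        exact sum_chain_le (dPsi2_triangle hX) (hG t) hℓk
    _ = _ := by ring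

/-- The contribution of the starting points of the chains. -/
lemma exists_bound_initial (hm : 1 ≤ m) (hX : ∀ t i, Measurable (X t i))
    (hD : ∀ t i, psiNorm 2 (X t i) (P i) ≤ D)
    (hπ : ∀ n, (Finset.univ.image (π n)).card ≤ 2 ^ 2 ^ n)
    {σ K : ℝ} (hσ : 0 < σ) (hK : 0 < K) (h : MomentCondition P X σ K)
    {p : ℝ} (hp : 1 ≤ p) (hpℓ : p ≤ 2 ^ (ℓ + 1)) (hℓp : 2 ^ ℓ ≤ p) :
    ∃ ξ : (∀ i, Ω i) → ℝ≥0∞, Measurable ξ ∧ ∫⁻ ω, ξ ω ^ p ∂(Measure.pi P) ≤ 2 ∧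
      ∀ᵐ ω ∂(Measure.pi P), ∀ t, ‖centeredSum P X (π ℓ t) ω‖ₑ
        ≤ 128 * (ξ ω * ENNReal.ofReal (√m * √p * σ + p * K)) := by
  -- The order `2^(ℓ+1)` lies between `p` and `2 * p`, and `v = 2` already compensates for the at
  -- most `2^(2^ℓ)` starting points.
  obtain ⟨ξ, hξm, hξ, h⟩ := exists_uniform_ratio (μ := Measure.pi P) (Finset.univ.image (π ℓ))
    (Z := fun s ω => ‖centeredSum P X s ω‖ₑ) (fun s => (measurable_centeredSum hX s).enorm)
    (w := fun _ => ENNReal.ofReal (16 * (2 * ((2 ^ (ℓ + 1) : ℕ) : ℝ) * K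
      + √m * √((2 ^ (ℓ + 1) : ℕ) : ℝ) * σ)))
    (fun _ _ => by finiteness) (q := fun _ => 2 ^ (ℓ + 1)) (p := p) (by linarith)
    (fun _ _ => by exact_mod_cast hpℓ)
    (fun s _ => lintegral_centeredSum_pow_le hm hX (hD s) hσ hK h Nat.one_le_two_pow)
    (v := 2) (by norm_num) (by
      rw [Finset.sum_const, nsmul_eq_mul]
      calc ((Finset.univ.image (π ℓ)).card : ℝ≥0∞) * (((2 : ℝ≥0) : ℝ≥0∞))⁻¹ ^ 2 ^ (ℓ + 1)
          ≤ ((2 ^ 2 ^ (ℓ + 1) : ℕ) : ℝ≥0∞) * (((2 : ℝ≥0) : ℝ≥0∞))⁻¹ ^ 2 ^ (ℓ + 1) := by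
            gcongr
            refine (hπ ℓ).trans ?_
            gcongr <;> omega
        _ = 1 := by
            push_cast
            rw [← mul_pow, ENNReal.mul_inv_cancel (by simp) (by simp), one_pow])
  refine ⟨ξ, hξm, hξ, ?_⟩
  filter_upwards [h] with ω hω t
  refine (hω (π ℓ t) (Finset.mem_image_of_mem _ (Finset.mem_univ t))).trans ?_
  have h2 : ((2 ^ (ℓ + 1) : ℕ) : ℝ) ≤ 2 * p := by
    push_cast
    rw [pow_succ]
    linarith
  have h3 : √((2 ^ (ℓ + 1) : ℕ) : ℝ) ≤ 2 * √p := by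
    rw [Real.sqrt_le_iff]
    refine ⟨by positivity, h2.trans ?_⟩
    rw [mul_pow, Real.sq_sqrt (by linarith)]
    linarith
  have h4 : 16 * (2 * ((2 ^ (ℓ + 1) : ℕ) : ℝ) * K + √m * √((2 ^ (ℓ + 1) : ℕ) : ℝ) * σ)
      ≤ 64 * (√m * √p * σ + p * K) := by
    have h5 : 2 * ((2 ^ (ℓ + 1) : ℕ) : ℝ) * K ≤ 2 * (2 * p) * K := by gcongr
    have h6 : √m * √((2 ^ (ℓ + 1) : ℕ) : ℝ) * σ ≤ √m * (2 * √p) * σ := by gcongr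
    have h7 : 0 ≤ √m * √p * σ := by positivity
    linarith
  calc _ ≤ ((2 : ℝ≥0) : ℝ≥0∞) * ξ ω * ENNReal.ofReal (64 * (√m * √p * σ + p * K)) := by
        gcongr
    _ = _ := by
        rw [ENNReal.ofReal_mul (by norm_num), ENNReal.ofReal_ofNat, ENNReal.coe_ofNat]
        ring

end Chaining

/-! ### Assembly of the moment bound and the tail bound. -/

section Main

variable {m : ℕ} {Ω : Fin m → Type*} {T : Type*} [∀ i, MeasurableSpace (Ω i)]
  {P : ∀ i, Measure (Ω i)} {X : T → ∀ i, Ω i → ℝ}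

lemma gammaTrunc_le_gammaFun {T : Type*} (α p : ℝ) (d : T → T → ℝ≥0∞) :
    gammaTrunc α p d ≤ gammaFun α d :=
  iInf₂_mono fun _ _ => iSup_mono fun _ =>
    ENNReal.tsum_comp_le_tsum_of_injective Subtype.val_injective _

lemma radPsi2_ne_top [Finite T] (h : ∀ t i, IsSubgaussian (X t i) (P i)) :
    radPsi2 P X ≠ ∞ := by
  cases nonempty_fintype T
  refine ne_top_of_le_ne_top (b := ∑ t, ∑ i, psiNorm 2 (X t i) (P i)) ?_
    (iSup_le fun t => iSup_le fun i => ?_)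
  · exact (ENNReal.sum_lt_top.2 fun t _ => ENNReal.sum_lt_top.2 fun i _ => h t i).ne
  · exact (Finset.single_le_sum (f := fun i => psiNorm 2 (X t i) (P i)) (fun _ _ => zero_le)
      (Finset.mem_univ i)).trans (Finset.single_le_sum
      (f := fun t => ∑ i, psiNorm 2 (X t i) (P i)) (fun _ _ => zero_le) (Finset.mem_univ t))

lemma supAvgSq_eq (hm : 1 ≤ m) (ω : ∀ i, Ω i) :
    supAvgSq P X ω = (m : ℝ≥0∞)⁻¹ * ⨆ t, ‖centeredSum P X t ω‖ₑ := by
  rw [supAvgSq, ENNReal.mul_iSup]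
  refine iSup_congr fun t => ?_
  rw [avgSq, ← Real.enorm_eq_ofReal_abs, enorm_mul]
  congr 1
  rw [Real.enorm_eq_ofReal_abs, one_div, abs_of_nonneg (by positivity),
    ENNReal.ofReal_inv_of_pos (by exact_mod_cast hm), ENNReal.ofReal_natCast]

lemma measurable_supAvgSq [Finite T] (hX : ∀ t i, Measurable (X t i)) (hm : 1 ≤ m) :
    Measurable (supAvgSq P X) := by
  have e : supAvgSq P X = fun ω => (m : ℝ≥0∞)⁻¹ * ⨆ t, ‖centeredSum P X t ω‖ₑ :=
    funext (supAvgSq_eq hm)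
  rw [e]
  exact (Measurable.iSup fun t => (measurable_centeredSum hX t).enorm).const_mul _

variable [∀ i, IsProbabilityMeasure (P i)]

/-- The moment bound for a single chain of approximations. -/
lemma lintegral_iSup_centeredSum_le [Fintype T] [DecidableEq T] (hm : 1 ≤ m)
    (hX : ∀ t i, Measurable (X t i)) {D : ℝ≥0} (hD : ∀ t i, psiNorm 2 (X t i) (P i) ≤ D)
    {σ K : ℝ} (hσ : 0 < σ) (hK : 0 < K) (h : MomentCondition P X σ K) {p : ℝ} (hp : 1 ≤ p)
    {π : ℕ → T → T} (hπ : ∀ n, (Finset.univ.image (π n)).card ≤ 2 ^ 2 ^ n)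
    (hfin : ∃ N, ∀ n, N ≤ n → ∀ t, π n t = t) {G : ℝ≥0∞}
    (hG : ∀ t, ∑' n : Set.Ici ⌊Real.logb 2 p⌋₊,
      (2 : ℝ≥0∞) ^ (((n : ℕ) : ℝ) / 2) * dPsi2 P X t (π n t) ≤ G) :
    (∫⁻ ω, (⨆ t, ‖centeredSum P X t ω‖ₑ) ^ p ∂(Measure.pi P)) ^ (1 / p)
      ≤ 40000 * (G ^ 2 + (NNReal.sqrt m : ℝ≥0) * D * G
        + ENNReal.ofReal (√m * √p * σ + p * K)) := by
  have hp0 : 0 < p := by linarith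
  have hlog : 0 ≤ Real.logb 2 p := Real.logb_nonneg one_lt_two hp
  set ℓ := ⌊Real.logb 2 p⌋₊ with hℓ
  have hℓp : (2 : ℝ) ^ ℓ ≤ p := by
    rw [← Real.rpow_natCast, ← Real.le_logb_iff_rpow_le one_lt_two hp0]
    exact Nat.floor_le hlog
  have hpℓ : p ≤ 2 ^ (ℓ + 1) := by
    rw [← Real.rpow_natCast, ← Real.logb_le_iff_le_rpow one_lt_two hp0]
    push_cast
    exact (Nat.lt_floor_add_one _).le
  -- Links at level `n` use order `2^(n+1)`, which is at most `m` for `ℓ ≤ n < k` and at least `m`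
  -- for `n ≥ k`. If `p` is large compared with `m`, the low range is empty.
  set k := max ℓ (Nat.log 2 m) with hk
  have hℓk : ℓ ≤ k := le_max_left _ _
  have hmk : m ≤ 2 ^ (k + 1) :=
    (Nat.lt_pow_succ_log_self one_lt_two m).le.trans
      (pow_le_pow_right₀ one_le_two (Nat.succ_le_succ (le_max_right _ _)))
  have hkm : ∀ n, ℓ ≤ n → n < k → 2 ^ (n + 1) ≤ m := fun n hn hnk =>
    (pow_le_pow_right₀ one_le_two (show n + 1 ≤ Nat.log 2 m by
      rcases lt_max_iff.1 hnk with h | h <;> omega)).trans (Nat.pow_log_le_self 2 (by omega))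
  obtain ⟨α, hαm, hα, h1⟩ := exists_bound_initial hm hX hD hπ hσ hK h hp hpℓ hℓp
  obtain ⟨ξ, hξm, hξ, h2⟩ := exists_bound_low_levels hX hD hπ hG hp hpℓ hℓk hkm
  obtain ⟨ζ, hζm, hζ, h3⟩ := exists_bound_high_levels hX hD hπ hfin hG hp hpℓ hℓk hmk
  set w := ENNReal.ofReal (√m * √p * σ + p * K) with hw
  set H := (NNReal.sqrt m : ℝ≥0) * (D : ℝ≥0∞) * G with hH
  -- The deterministic error uses only the level `k` term of the `γ₂` sum, whose weight satisfies `2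
  -- * 2^(k/2) ≥ √m`.
  have hmd : ∀ t, m * dPsi2 P X t (π k t) * D ≤ 2 * H := by
    intro t
    have hd : (2 : ℝ≥0∞) ^ ((k : ℝ) / 2) * dPsi2 P X t (π k t) ≤ G := by
      refine le_trans ?_ ((sum_le_tsum_Ici (I := {k}) (ℓ := ℓ)
        (f := fun n => (2 : ℝ≥0∞) ^ ((n : ℝ) / 2) * dPsi2 P X t (π n t))
        (by simpa using hℓk)).trans (hG t))
      rw [Finset.sum_singleton]
    have hs : ((NNReal.sqrt m : ℝ≥0) : ℝ≥0∞) ≤ 2 * (2 : ℝ≥0∞) ^ ((k : ℝ) / 2) := by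
      refine le_trans ?_ (two_rpow_succ_le k)
      rw [← sqrt_two_pow_eq]
      exact_mod_cast NNReal.sqrt_le_sqrt.2 (by exact_mod_cast hmk)
    have hmm : (m : ℝ≥0∞) = (NNReal.sqrt m : ℝ≥0) * (NNReal.sqrt m : ℝ≥0) := by
      rw [← ENNReal.coe_mul, NNReal.mul_self_sqrt, ENNReal.coe_natCast]
    calc m * dPsi2 P X t (π k t) * D
        = (NNReal.sqrt m : ℝ≥0) * D * ((NNReal.sqrt m : ℝ≥0) * dPsi2 P X t (π k t)) := by
          rw [hmm]; ring
      _ ≤ (NNReal.sqrt m : ℝ≥0) * D *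
          (2 * (2 : ℝ≥0∞) ^ ((k : ℝ) / 2) * dPsi2 P X t (π k t)) := by gcongr
      _ = (NNReal.sqrt m : ℝ≥0) * D *
          (2 * ((2 : ℝ≥0∞) ^ ((k : ℝ) / 2) * dPsi2 P X t (π k t))) := by rw [mul_assoc 2]
      _ ≤ (NNReal.sqrt m : ℝ≥0) * D * (2 * G) := by gcongr
      _ = 2 * H := by rw [hH]; ring
  have hpt : ∀ᵐ ω ∂(Measure.pi P), ⨆ t, ‖centeredSum P X t ω‖ₑ
      ≤ α ω * (256 * w) + (ξ ω * (12288 * H) + (ζ ω ^ 2 * (18432 * G ^ 2 + 192 * H) + 196 * H)) := by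
    filter_upwards [h1, h2, h3] with ω h1 h2 h3
    refine iSup_le fun t => (enorm_centeredSum_le hX hD t (π k t) ω).trans ?_
    -- This rewrites the cross term linear in `ζ` through `ζ²`, the quantity whose `p`-th moment is
    -- controlled.
    have hζ1 : ζ ω ≤ 1 + ζ ω ^ 2 := by
      simpa using rpow_le_one_add_pow (ζ ω) zero_le_one (q := 2) (by norm_num)
    calc 2 * ‖centeredSum P X (π k t) ω‖ₑ + 2 * ‖sampleDist X t (π k t) ω‖ₑ ^ 2
          + 2 * (NNReal.sqrt m : ℝ≥0) * D * ‖sampleDist X t (π k t) ω‖ₑ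
          + 2 * m * dPsi2 P X t (π k t) * D
        ≤ 2 * (128 * (α ω * w) + 6144 * (ξ ω * H)) + 2 * (96 * (ζ ω * G)) ^ 2
          + 2 * (NNReal.sqrt m : ℝ≥0) * D * (96 * (ζ ω * G))
          + 2 * (m * dPsi2 P X t (π k t) * D) := by
          rw [mul_assoc 2 (m : ℝ≥0∞), mul_assoc 2 (m * dPsi2 P X t (π k t))]
          gcongr
          · exact (h2 t).trans (add_le_add (h1 t) le_rfl)
          · exact h3 t
          · exact h3 t
      _ ≤ 2 * (128 * (α ω * w) + 6144 * (ξ ω * H)) + 2 * (96 * (ζ ω * G)) ^ 2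
          + 192 * ((1 + ζ ω ^ 2) * H) + 2 * (2 * H) := by
          gcongr ?_ + ?_ + ?_ + ?_
          · exact le_rfl
          · exact le_rfl
          · calc 2 * (NNReal.sqrt m : ℝ≥0) * D * (96 * (ζ ω * G)) = 192 * (ζ ω * H) := by
                  rw [hH]; ring
              _ ≤ _ := by gcongr
          · exact mul_le_mul' le_rfl (hmd t)
      _ = _ := by ring
  calc (∫⁻ ω, (⨆ t, ‖centeredSum P X t ω‖ₑ) ^ p ∂(Measure.pi P)) ^ (1 / p)
      ≤ (∫⁻ ω, (α ω * (256 * w) + (ξ ω * (12288 * H)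
        + (ζ ω ^ 2 * (18432 * G ^ 2 + 192 * H) + 196 * H))) ^ p ∂(Measure.pi P)) ^ (1 / p) := by
        refine ENNReal.rpow_le_rpow (lintegral_mono_ae ?_) (by positivity)
        filter_upwards [hpt] with ω hω
        exact ENNReal.rpow_le_rpow hω hp0.le
    _ ≤ 2 * (256 * w) + (2 * (12288 * H) + (2 * (18432 * G ^ 2 + 192 * H) + 196 * H)) :=
        lintegral_rpow_combination_le hαm hξm (hζm.pow_const 2) hp hα hξ hζ _ _ _ _
    _ = 512 * w + (25156 * H + 36864 * G ^ 2) := by ring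
    _ ≤ 40000 * w + (40000 * H + 40000 * G ^ 2) := by gcongr <;> norm_num
    _ = _ := by ring

/-- The moment bound in terms of the truncated `γ₂`-functional. -/
lemma lintegral_supAvgSq_le [Finite T] [Nonempty T] (hm : 1 ≤ m)
    (hX : ∀ t i, Measurable (X t i)) (hsub : ∀ t i, IsSubgaussian (X t i) (P i))
    {σ K : ℝ} (hσ : 0 < σ) (hK : 0 < K) (h : MomentCondition P X σ K) {p : ℝ} (hp : 1 ≤ p) :
    (∫⁻ ω, supAvgSq P X ω ^ p ∂(Measure.pi P)) ^ (1 / p)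
      ≤ 40000 * ((m : ℝ≥0∞)⁻¹ * gammaTrunc 2 p (dPsi2 P X) ^ 2
        + ENNReal.ofReal (1 / √(m : ℝ)) * radPsi2 P X * gammaTrunc 2 p (dPsi2 P X)
        + ENNReal.ofReal (√p * σ / √(m : ℝ) + p * K / m)) := by
  classical
  cases nonempty_fintype T
  have hp0 : 0 < p := by linarith
  have hm0 : (0 : ℝ) < m := by exact_mod_cast hm
  have hm1 : (m : ℝ≥0∞)⁻¹ ≠ ∞ := by simp; omega
  have hmr : (m : ℝ≥0∞)⁻¹ = ENNReal.ofReal ((m : ℝ)⁻¹) := by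
    rw [ENNReal.ofReal_inv_of_pos hm0, ENNReal.ofReal_natCast]
  have hrad := radPsi2_ne_top hsub
  rcases eq_or_ne (gammaTrunc 2 p (dPsi2 P X)) ∞ with htop | htop
  · rw [htop]
    simp
  -- Any `G` above the infimum is realised by some admissible sequence; continuity then lets `G`
  -- decrease to it.
  refine le_of_forall_gt_of_continuous (f := fun g => 40000 * ((m : ℝ≥0∞)⁻¹ * g ^ 2
    + ENNReal.ofReal (1 / √(m : ℝ)) * radPsi2 P X * g
    + ENNReal.ofReal (√p * σ / √(m : ℝ) + p * K / m))) ?_ htop fun G hG => ?_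
  · exact (ENNReal.continuous_const_mul (by finiteness)).comp
      ((((ENNReal.continuous_const_mul hm1).comp (ENNReal.continuous_pow 2)).add
      (ENNReal.continuous_const_mul (by finiteness))).add continuous_const)
  obtain ⟨S, hS⟩ := iInf_lt_iff.1 hG
  obtain ⟨hadm, hS⟩ := iInf_lt_iff.1 hS
  obtain ⟨π, hπ, hfin, hdist⟩ := exists_chain (d := dPsi2 P X) dPsi2_self hadm
  obtain ⟨D, hD⟩ : ∃ D : ℝ≥0, (D : ℝ≥0∞) = radPsi2 P X := ⟨_, ENNReal.coe_toNNReal hrad⟩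
  have hDle : ∀ t i, psiNorm 2 (X t i) (P i) ≤ D := fun t i => by
    rw [hD]
    exact le_iSup₂ (f := fun t i => psiNorm 2 (X t i) (P i)) t i
  have hmain := lintegral_iSup_centeredSum_le (G := G) hm hX hDle hσ hK h hp hπ hfin fun t => by
    refine le_trans (ENNReal.tsum_le_tsum fun n => ?_) ((le_iSup (fun t => ∑' n : Set.Ici
      ⌊Real.logb 2 p⌋₊, (2 : ℝ≥0∞) ^ (((n : ℕ) : ℝ) / 2) * distTo (dPsi2 P X) t (S n)) t).trans
      hS.le)
    gcongr
    exact hdist _ _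
  have hsqrt : (m : ℝ≥0∞)⁻¹ * (NNReal.sqrt m : ℝ≥0) = ENNReal.ofReal (1 / √(m : ℝ)) := by
    rw [hmr, ← ENNReal.ofReal_coe_nnreal, ← ENNReal.ofReal_mul (by positivity)]
    congr 1
    rw [Real.coe_sqrt, NNReal.coe_natCast]
    field_simp
    rw [Real.sq_sqrt hm0.le]
  have hlast : (m : ℝ≥0∞)⁻¹ * ENNReal.ofReal (√m * √p * σ + p * K)
      = ENNReal.ofReal (√p * σ / √(m : ℝ) + p * K / m) := by
    rw [hmr, ← ENNReal.ofReal_mul (by positivity)]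
    congr 1
    have := Real.sq_sqrt hm0.le
    have hs : √(m : ℝ) ≠ 0 := (Real.sqrt_pos.2 hm0).ne'
    have e : (m : ℝ)⁻¹ * √m = 1 / √m := by
      field_simp
      exact this
    calc (m : ℝ)⁻¹ * (√m * √p * σ + p * K) = ((m : ℝ)⁻¹ * √m) * (√p * σ) + p * K / m := by ring
      _ = _ := by rw [e]; ring
  calc (∫⁻ ω, supAvgSq P X ω ^ p ∂(Measure.pi P)) ^ (1 / p)
      = (m : ℝ≥0∞)⁻¹ *
        (∫⁻ ω, (⨆ t, ‖centeredSum P X t ω‖ₑ) ^ p ∂(Measure.pi P)) ^ (1 / p) := by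
        simp_rw [supAvgSq_eq hm, ENNReal.mul_rpow_of_nonneg _ _ hp0.le]
        rw [lintegral_const_mul' _ _ (by finiteness),
          ENNReal.mul_rpow_of_nonneg _ _ (by positivity), ← ENNReal.rpow_mul,
          mul_one_div_cancel hp0.ne', ENNReal.rpow_one]
    _ ≤ (m : ℝ≥0∞)⁻¹ * (40000 * ((G : ℝ≥0∞) ^ 2 + (NNReal.sqrt m : ℝ≥0) * D * G
        + ENNReal.ofReal (√m * √p * σ + p * K))) := by gcongr
    _ = 40000 * ((m : ℝ≥0∞)⁻¹ * (G : ℝ≥0∞) ^ 2 + ((m : ℝ≥0∞)⁻¹ * (NNReal.sqrt m : ℝ≥0)) * D * G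
        + (m : ℝ≥0∞)⁻¹ * ENNReal.ofReal (√m * √p * σ + p * K)) := by ring
    _ = _ := by rw [hsqrt, hlast, hD]

end Main

/-- Markov's inequality for a moment of order `u`. -/
lemma measure_le_exp_neg {Ω : Type*} [MeasurableSpace Ω] {μ : Measure Ω} {f : Ω → ℝ≥0∞}
    (hf : Measurable f) (hfin : ∀ ω, f ω ≠ ∞) {u : ℝ} (hu : 1 ≤ u) {A : ℝ≥0∞} (hA : A ≠ 0)
    (h : (∫⁻ ω, f ω ^ u ∂μ) ^ (1 / u) ≤ A) :
    μ {ω | 3 * A ≤ f ω} ≤ ENNReal.ofReal (Real.exp (-u)) := by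
  have hu0 : 0 < u := by linarith
  rcases eq_or_ne A ∞ with rfl | hA'
  · have : {ω | 3 * ∞ ≤ f ω} = ∅ := Set.eq_empty_of_forall_notMem fun ω hω => by
      rw [Set.mem_ofPred_eq, ENNReal.mul_top (by norm_num), top_le_iff] at hω
      exact hfin ω hω
    rw [this]
    simp
  have h1 : ∫⁻ ω, f ω ^ u ∂μ ≤ A ^ u := by
    rw [one_div] at h
    exact (ENNReal.rpow_inv_le_iff hu0).1 h
  have h2 := mul_meas_ge_le_lintegral₀ (μ := μ) (hf.pow_const u).aemeasurable ((3 * A) ^ u)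
  have hset : {ω | (3 * A) ^ u ≤ f ω ^ u} = {ω | 3 * A ≤ f ω} := by
    ext ω
    exact ENNReal.rpow_le_rpow_iff hu0
  rw [hset, ENNReal.mul_rpow_of_nonneg _ _ hu0.le] at h2
  have h3 : A ^ u * (3 ^ u * μ {ω | 3 * A ≤ f ω}) ≤ A ^ u * 1 := by
    rw [mul_one]
    refine le_trans (le_of_eq ?_) (h2.trans h1)
    ring
  have h4 : (3 : ℝ≥0∞) ^ u * μ {ω | 3 * A ≤ f ω} ≤ 1 :=
    (ENNReal.mul_le_mul_iff_right (by simp [hA, hA'])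
      (ENNReal.rpow_ne_top_of_nonneg hu0.le hA')).1 h3
  -- Markov at height `3 * A` gives probability at most `3^(-u)`, and `3 > e`.
  have h5 : ENNReal.ofReal (Real.exp u) ≤ 3 ^ u := by
    rw [← ENNReal.ofReal_ofNat 3, ENNReal.ofReal_rpow_of_pos (by norm_num)]
    refine ENNReal.ofReal_le_ofReal ?_
    rw [← Real.exp_one_rpow]
    gcongr
    linarith [Real.exp_one_lt_d9]
  rw [Real.exp_neg, ENNReal.ofReal_inv_of_pos (Real.exp_pos u)]
  rw [ENNReal.le_inv_iff_mul_le, mul_comm]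
  exact (mul_le_mul' h5 le_rfl).trans h4

end SupAverages


theorem theorem5p5 :
    ∃ C₀ C c : ℝ≥0, 0 < C₀ ∧ 0 < C ∧ 0 < c ∧
      ∀ (m : ℕ) (_ : 1 ≤ m)
        (Ω : Fin m → Type*) [∀ i, MeasurableSpace (Ω i)]
        (P : ∀ i, Measure (Ω i)) [∀ i, IsProbabilityMeasure (P i)]
        (T : Type*) [Finite T] [Nonempty T]
        (X : T → ∀ i, Ω i → ℝ)
        (_ : ∀ t i, Measurable (X t i))
        (_ : ∀ t i, SupAverages.IsSubgaussian (X t i) (P i))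
        (σ K : ℝ) (_ : 0 < σ) (_ : 0 < K)
        (_ : SupAverages.MomentCondition P X σ K),
        (∀ p : ℝ, 1 ≤ p →
          (∫⁻ ω, SupAverages.supAvgSq P X ω ^ p ∂(Measure.pi P)) ^ (1 / p) ≤
            C₀ * ((m : ℝ≥0∞)⁻¹ * SupAverages.gammaTrunc 2 p (SupAverages.dPsi2 P X) ^ 2
              + ENNReal.ofReal (1 / √(m : ℝ)) * SupAverages.radPsi2 P X
                  * SupAverages.gammaTrunc 2 p (SupAverages.dPsi2 P X)
              + ENNReal.ofReal (√p * σ / √(m : ℝ) + p * K / m))) ∧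
        (∀ u : ℝ, 1 ≤ u →
          Measure.pi P {ω |
            C * ((m : ℝ≥0∞)⁻¹ * SupAverages.gammaFun 2 (SupAverages.dPsi2 P X) ^ 2
              + ENNReal.ofReal (1 / √(m : ℝ)) * SupAverages.radPsi2 P X
                  * SupAverages.gammaFun 2 (SupAverages.dPsi2 P X))
              + c * ENNReal.ofReal (√u * σ / √(m : ℝ) + u * K / m)
              ≤ SupAverages.supAvgSq P X ω}
            ≤ ENNReal.ofReal (Real.exp (-u))) := by
  -- The tail constants are three times the moment constant, the `3` being the one in Markov's
  -- inequality.
  refine ⟨40000, 120000, 120000, by norm_num, by norm_num, by norm_num, ?_⟩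
  intro m hm Ω _ P _ T _ _ X hX hsub σ K hσ hK hmom
  have hmoment : ∀ p : ℝ, 1 ≤ p → _ := fun p hp =>
    SupAverages.lintegral_supAvgSq_le hm hX hsub hσ hK hmom (p := p) hp
  refine ⟨fun p hp => by simpa only [ENNReal.coe_ofNat] using hmoment p hp, fun u hu => ?_⟩
  have hm0 : (0 : ℝ) < m := by exact_mod_cast hm
  set γ := SupAverages.gammaFun 2 (SupAverages.dPsi2 P X) with hγ
  have hle := SupAverages.gammaTrunc_le_gammaFun 2 u (SupAverages.dPsi2 P X)
  have hfin : ∀ ω, SupAverages.supAvgSq P X ω ≠ ∞ := fun ω => by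
    cases nonempty_fintype T
    refine ne_top_of_le_ne_top (b := ∑ t, ENNReal.ofReal |SupAverages.avgSq P X t ω|)
      (ENNReal.sum_lt_top.2 fun t _ => ENNReal.ofReal_lt_top).ne (iSup_le fun t => ?_)
    exact Finset.single_le_sum (f := fun t => ENNReal.ofReal |SupAverages.avgSq P X t ω|)
      (fun _ _ => zero_le) (Finset.mem_univ t)
  -- Markov's inequality divides by `A^u`; positivity of `σ` and `K` keeps `A` nonzero even if `γ`
  -- vanishes.
  have hpos : 0 < √u * σ / √(m : ℝ) + u * K / m := by
    have : 0 < √u := Real.sqrt_pos.2 (by linarith)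
    positivity
  have h := SupAverages.measure_le_exp_neg (μ := Measure.pi P)
    (SupAverages.measurable_supAvgSq hX hm) hfin hu
    (A := 40000 * ((m : ℝ≥0∞)⁻¹ * γ ^ 2
      + ENNReal.ofReal (1 / √(m : ℝ)) * SupAverages.radPsi2 P X * γ
      + ENNReal.ofReal (√u * σ / √(m : ℝ) + u * K / m)))
    (by
      refine mul_ne_zero (by norm_num) (ne_of_gt ?_)
      exact (ENNReal.ofReal_pos.2 hpos).trans_le le_add_self)
    ((hmoment u hu).trans (by gcongr))
  refine le_trans (le_of_eq ?_) h
  congr 1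
  ext ω
  simp only [ENNReal.coe_ofNat, Set.mem_ofPred_eq]
  refine iff_of_eq (congrArg (· ≤ SupAverages.supAvgSq P X ω) ?_)
  ring
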